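/- Let $\Phi\in C^2(\mathbb R^n,\mathbb R)$ satisfy $\int_{\mathbb R^n} e^{-\Phi(x)}\,dx=1$ and be strictly convex in the sense that its Hessian $\Phi''=(\partial_j\partial_k\Phi)_{j,k}$ satisfies $$\sum_{j,k}\Phi''_{jk}(x)\,z_j\overline{z_k}>0\qquad\text{for all }x\in\mathbb R^n\text{ and all }z\in\mathbb C^n\setminus\{0\}$$ (no uniform lower bound is assumed). Let $\mu$ be the probability measure $d\mu=e^{-\Phi(x)}\,dx$. Then for every complex-valued $f\in L^2(\mathbb R^n,\mu)\cap H^1_{\mathrm{loc}}(\mathbb R^n)$, with mean $\langle f\rangle=\int f\,d\mu$ and weak (distributional) gradient $\nabla f$, the Brascamp–Lieb inequality holds: $$\int_{\mathbb R^n}|f(x)-\langle f\rangle|^2e^{-\Phi(x)}\,dx\;\le\;\int_{\mathbb R^n}\bigl(\nabla f(x)^T\,\Phi''(x)^{-1}\,\overline{\nabla f(x)}\bigr)e^{-\Phi(x)}\,dx .$$ The integrand on the right-hand side is nonnegative, and its integral may be $+\infty$. Here $H^1_{\mathrm{loc}}(\mathbb R^n)$ is the space of functions that, together with their first-order weak derivatives,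 belong to $L^2_{\mathrm{loc}}(\mathbb R^n)$ with respect to Lebesgue measure. -/

import Mathlib

open MeasureTheory
open scoped ContDiff Matrix ComplexOrder ComplexConjugate

noncomputable section

/-- The classical partial derivative `∂_j u` of a function `u` on `ℝⁿ`. -/
def partialDeriv {n : ℕ} {F : Type*} [NormedAddCommGroup F] [NormedSpace ℝ F]
    (j : Fin n) (u : EuclideanSpace ℝ (Fin n) → F) (x : EuclideanSpace ℝ (Fin n)) : F :=
  fderiv ℝ u x (EuclideanSpace.single j 1)

/-- The Hessian matrix `Φ''(x) = (∂_j ∂_k Φ (x))_{j,k}`. -/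
def hessian {n : ℕ} (Φ : EuclideanSpace ℝ (Fin n) → ℝ) (x : EuclideanSpace ℝ (Fin n)) :
    Matrix (Fin n) (Fin n) ℝ :=
  Matrix.of fun j k => partialDeriv j (partialDeriv k Φ) x

/-- The measure `dμ = e^{-Φ(x)} dx` on `ℝⁿ`. -/
def potentialMeasure {n : ℕ} (Φ : EuclideanSpace ℝ (Fin n) → ℝ) :
    Measure (EuclideanSpace ℝ (Fin n)) :=
  volume.withDensity fun x => ENNReal.ofReal (Real.exp (-Φ x))

/-- `u ∈ L²_loc(ℝⁿ)`: square integrable over every compact set, for Lebesgue measure. -/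
def MemL2loc {n : ℕ} (u : EuclideanSpace ℝ (Fin n) → ℂ) : Prop :=
  ∀ K : Set (EuclideanSpace ℝ (Fin n)), IsCompact K → MemLp u 2 (volume.restrict K)

/-- `g` is the weak (distributional) gradient of `f`: both are locally integrable, and
`∫ f ∂_j φ dx = - ∫ g_j φ dx` for every `j` and every test function `φ ∈ C_c^∞(ℝⁿ, ℂ)`. -/
structure IsWeakGradient {n : ℕ} (f : EuclideanSpace ℝ (Fin n) → ℂ)
    (g : EuclideanSpace ℝ (Fin n) → Fin n → ℂ) : Prop where
  locallyIntegrable : LocallyIntegrable f volume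
  locallyIntegrable_grad : ∀ j, LocallyIntegrable (fun x => g x j) volume
  integral_eq : ∀ (j : Fin n) (φ : EuclideanSpace ℝ (Fin n) → ℂ),
    ContDiff ℝ ∞ φ → HasCompactSupport φ →
      ∫ x, f x * partialDeriv j φ x = -∫ x, g x j * φ x

/-- `f ∈ H¹_loc(ℝⁿ)`: `f` is in `L²_loc` and has a weak gradient with components in `L²_loc`. -/
def MemH1loc {n : ℕ} (f : EuclideanSpace ℝ (Fin n) → ℂ) : Prop :=
  MemL2loc f ∧ ∃ g : EuclideanSpace ℝ (Fin n) → Fin n → ℂ,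
    IsWeakGradient f g ∧ ∀ j, MemL2loc fun x => g x j

/-- The Hermitian form `vᵀ A⁻¹ v̄` of the inverse of a real matrix, at `v ∈ ℂⁿ`. It is a
nonnegative real number whenever `A` is positive definite (see `invForm_nonneg`). -/
def invForm {n : ℕ} (A : Matrix (Fin n) (Fin n) ℝ) (v : Fin n → ℂ) : ℂ :=
  v ⬝ᵥ (A⁻¹.map Complex.ofReal *ᵥ star v)

/-- If `A` is positive definite, then `vᵀ A⁻¹ v̄` is a nonnegative real number. -/
theorem invForm_nonneg {n : ℕ} {A : Matrix (Fin n) (Fin n) ℝ} (hA : A.PosDef) (v : Fin n → ℂ) :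
    0 ≤ invForm A v := by
  obtain ⟨m, w, hw⟩ := Matrix.posSemidef_iff_eq_sum_vecMulVec.mp hA.inv.posSemidef
  have h1 : invForm A v = ∑ i, (∑ j, v j * (w i j : ℂ)) * star (∑ j, v j * (w i j : ℂ)) := by
    have h2 : ∀ j k, ((A⁻¹ j k : ℝ) : ℂ) = ∑ i, (w i j : ℂ) * (w i k : ℂ) := by
      intro j k
      rw [hw]
      simp [Matrix.sum_apply, Matrix.vecMulVec_apply]
    simp only [invForm, dotProduct, Matrix.mulVec, Matrix.map_apply, h2, star_sum, star_mul',
      Finset.sum_mul_sum, Pi.star_apply]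
    rw [Finset.sum_comm]
    refine Finset.sum_congr rfl fun j _ => ?_
    rw [Finset.sum_comm, Finset.mul_sum]
    refine Finset.sum_congr rfl fun k _ => ?_
    rw [Finset.sum_mul, Finset.mul_sum]
    refine Finset.sum_congr rfl fun i _ => ?_
    simp only [Complex.star_def, Complex.conj_ofReal]
    ring
  rw [h1]
  exact Finset.sum_nonneg fun i _ => mul_star_self_nonneg _

end

/-! The inequality is the second-order term of the Prékopa–Leindler inequality. Put `q = ∇fᵀ Φ''⁻¹
∇f` for real `f` of class C¹, `x = z + w` and `y = z - w`. To leading order, `ε (f x - f y) - (Φ x +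
Φ y - 2 Φ z)` is `2 ε ∇f(z)·w - w·Φ''(z) w`, whose maximum over `w` is `ε² q(z)`. Hence `exp(-Φ + ε
f)`, `exp(-Φ - ε f)` and `exp(-Φ + ε² (q + η) / 2)` satisfy the midpoint hypothesis for small `ε` on
a compact convex set (`midpoint_le`), where strict convexity is automatically uniform.

Prékopa–Leindler (`midpointPrekopaLeindler_euclideanSpace`) then bounds `∫ exp(ε f) dμ · ∫ exp(-ε f)
dμ` by `(∫ exp(ε² (q + η) / 2) dμ)²`. Symmetrised over pairs of points, the left side contains the
integral of `(f x - f y)²`, which is twice the variance when the total mass is one. Comparing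
coefficients of `ε²` and letting `η → 0` gives the estimate on the compact set
(`lintegral_sq_sub_le_of_contDiff`).

A function with a weak gradient is mollified. The inverse form is a supremum of functions affine in
the vector, so Jensen's inequality controls the mollified gradient up to a factor tending to one
(`setLIntegral_realInvForm_convolution_le`), and Fatou's lemma handles the left side. Balls exhaust
the space, and real and imaginary parts add up. -/

open Filter Topology
open scoped ENNReal Pointwise Convolution

/-! ### The midpoint Prékopa–Leindler inequality -/

/-- One-dimensional Brunn–Minkowski inequality for nonempty compact sets. -/
theorem volume_add_volume_le_volume_add {A B : Set ℝ} (hA : IsCompact A) (hB : IsCompact B)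
    (hA' : A.Nonempty) (hB' : B.Nonempty) : volume A + volume B ≤ volume (A + B) := by
  -- With `a = max A` and `b = min B`, the translates `A + b` and `a + B` both lie in `A + B` and
  -- can meet only at `a + b`.
  obtain ⟨a, ha, hamax⟩ := hA.exists_isGreatest hA'
  obtain ⟨b, hb, hbmin⟩ := hB.exists_isLeast hB'
  have h1 : volume A = volume ((fun x => x + b) '' A) := by
    simp
  have h2 : volume B = volume ((fun x => a + x) '' B) := by
    simp
  have hmeas : MeasurableSet ((fun x => a + x) '' B) :=
    (hB.image (by fun_prop)).measurableSet
  have hint : volume (((fun x => x + b) '' A) ∩ ((fun x => a + x) '' B)) = 0 := by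
    refine measure_mono_null (t := {a + b}) ?_ (by simp)
    rintro _ ⟨⟨x, hx, rfl⟩, ⟨y, hy, hxy⟩⟩
    have := hamax hx
    have := hbmin hy
    simp only at hxy
    simp only [Set.mem_singleton_iff]
    linarith
  rw [h1, h2, ← measure_union_add_inter _ hmeas, hint, add_zero]
  refine measure_mono (Set.union_subset ?_ ?_)
  · rintro _ ⟨x, hx, rfl⟩
    exact Set.add_mem_add hx hb
  · rintro _ ⟨x, hx, rfl⟩
    exact Set.add_mem_add ha hx

theorem volume_add_volume_le_two_mul {A B C : Set ℝ} (hA : MeasurableSet A) (hB : MeasurableSet B)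
    (hA' : A.Nonempty) (hB' : B.Nonempty)
    (hC : ∀ x ∈ A, ∀ y ∈ B, (1 / 2 : ℝ) • (x + y) ∈ C) :
    volume A + volume B ≤ 2 * volume C := by
  obtain ⟨a, ha⟩ := hA'
  obtain ⟨b, hb⟩ := hB'
  rw [hA.measure_eq_iSup_isCompact, hB.measure_eq_iSup_isCompact]
  have key : ∀ K ⊆ A, IsCompact K → ∀ L ⊆ B, IsCompact L →
      volume K + volume L ≤ 2 * volume C := by
    intro K hKA hK L hLB hL
    -- The approximating compact sets may be empty; inserting a point of `A` and one of `B` makes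
    -- the sumset bound applicable.
    have h := volume_add_volume_le_volume_add (hK.insert a) (hL.insert b)
      (Set.insert_nonempty _ _) (Set.insert_nonempty _ _)
    have hsub : insert a K + insert b L ⊆ (2 : ℝ) • C := by
      rintro _ ⟨x, hx, y, hy, rfl⟩
      have hx' : x ∈ A := by rcases hx with rfl | hx; exacts [ha, hKA hx]
      have hy' : y ∈ B := by rcases hy with rfl | hy; exacts [hb, hLB hy]
      exact ⟨_, hC x hx' y hy', by simp⟩
    calc volume K + volume L ≤ volume (insert a K) + volume (insert b L) := by
          gcongr <;> exact Set.subset_insert _ _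
      _ ≤ volume ((2 : ℝ) • C) := h.trans (measure_mono hsub)
      _ = 2 * volume C := by simp [Measure.addHaar_smul]
  simp only [iSup_and']
  refine ENNReal.biSup_add_biSup_le' (ι := Set ℝ) (κ := Set ℝ) ⟨∅, by simp⟩ ⟨∅, by simp⟩ ?_
  rintro K ⟨h1, h2⟩ L ⟨h3, h4⟩
  exact key K h1 h2 L h3 h4

/-- Layer-cake formula and the set inequality at each level. The common supremum one makes both
superlevel sets nonempty below level one and empty above it; without this normalisation one of them
could be empty alone and the set inequality would fail. -/
theorem lintegral_add_lintegral_le_of_sup_one {u v h : ℝ → ℝ} (hu : Measurable u)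
    (hv : Measurable v) (hh : Measurable h) (hu0 : ∀ x, 0 ≤ u x) (hv0 : ∀ x, 0 ≤ v x)
    (hh0 : ∀ x, 0 ≤ h x) (hu1 : ∀ x, u x ≤ 1) (hv1 : ∀ x, v x ≤ 1)
    (hus : ∀ t < 1, ∃ x, t < u x) (hvs : ∀ t < 1, ∃ x, t < v x)
    (huv : ∀ x y, u x * v y ≤ h ((1 / 2 : ℝ) • (x + y)) ^ 2) :
    (∫⁻ x, ENNReal.ofReal (u x)) + ∫⁻ x, ENNReal.ofReal (v x) ≤
      2 * ∫⁻ x, ENNReal.ofReal (h x) := by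
  rw [lintegral_eq_lintegral_meas_lt _ (.of_forall hu0) hu.aemeasurable,
    lintegral_eq_lintegral_meas_lt _ (.of_forall hv0) hv.aemeasurable,
    lintegral_eq_lintegral_meas_lt _ (.of_forall hh0) hh.aemeasurable]
  have hanti : ∀ w : ℝ → ℝ, Measurable fun t => volume {a : ℝ | t < w a} := fun w =>
    Antitone.measurable fun s t hst => measure_mono fun a (ha : t < w a) => hst.trans_lt ha
  rw [← lintegral_add_left (hanti u), ← lintegral_const_mul _ (hanti h)]
  refine lintegral_mono_ae ?_
  filter_upwards [ae_restrict_mem measurableSet_Ioi] with t ht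
  rcases lt_or_ge t 1 with h1 | h1
  · refine volume_add_volume_le_two_mul (measurableSet_lt measurable_const hu)
      (measurableSet_lt measurable_const hv) (hus t h1) (hvs t h1) ?_
    intro x (hx : t < u x) y (hy : t < v y)
    have ht : 0 < t := ht
    have : t ^ 2 < h ((1 / 2 : ℝ) • (x + y)) ^ 2 :=
      lt_of_lt_of_le (by nlinarith) (huv x y)
    exact lt_of_pow_lt_pow_left₀ 2 (hh0 _) this
  · have e1 : {a | t < u a} = ∅ := by
      ext a; simpa using (hu1 a).trans h1
    have e2 : {a | t < v a} = ∅ := by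
      ext a; simpa using (hv1 a).trans h1
    simp [e1, e2]

/-- The Prékopa–Leindler inequality at the midpoint holds for the measure `μ`. -/
def MidpointPrekopaLeindler {α : Type*} [AddCommGroup α] [Module ℝ α] [MeasurableSpace α]
    (μ : Measure α) : Prop :=
  ∀ u v h : α → ℝ≥0∞, Measurable u → Measurable v → Measurable h →
    (∀ x y, u x * v y ≤ h ((1 / 2 : ℝ) • (x + y)) ^ 2) →
    (∫⁻ x, u x ∂μ) * ∫⁻ x, v x ∂μ ≤ (∫⁻ x, h x ∂μ) ^ 2

theorem ENNReal.four_mul_le_add_sq (a b : ℝ≥0∞) : 4 * (a * b) ≤ (a + b) ^ 2 := by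
  rcases eq_or_ne a ⊤ with rfl | ha
  · simp
  rcases eq_or_ne b ⊤ with rfl | hb
  · simp
  lift a to NNReal using ha
  lift b to NNReal using hb
  norm_cast
  have := four_mul_le_sq_add a b
  rwa [mul_assoc] at this

/-- Dividing by the suprema `a`, `b` and by `c = √(ab)` reduces to supremum one. The resulting
additive bound is stronger than the multiplicative one, by the arithmetic–geometric mean inequality.
Truncating `h / c` at one keeps it finite without losing the hypothesis. -/
theorem prekopaLeindler_real_of_bounded {u v h : ℝ → ℝ≥0∞} (hu : Measurable u)
    (hv : Measurable v) (hh : Measurable h) {M N : ℝ≥0∞} (hM : M ≠ ⊤) (hN : N ≠ ⊤)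
    (huM : ∀ x, u x ≤ M) (hvN : ∀ x, v x ≤ N)
    (huv : ∀ x y, u x * v y ≤ h ((1 / 2 : ℝ) • (x + y)) ^ 2) :
    (∫⁻ x, u x) * ∫⁻ x, v x ≤ (∫⁻ x, h x) ^ 2 := by
  set a := ⨆ x, u x with ha
  set b := ⨆ x, v x with hb
  have hua : ∀ x, u x ≤ a := le_iSup u
  have hvb : ∀ x, v x ≤ b := le_iSup v
  have haT : a ≠ ⊤ := ne_top_of_le_ne_top hM (iSup_le huM)
  have hbT : b ≠ ⊤ := ne_top_of_le_ne_top hN (iSup_le hvN)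
  rcases eq_or_ne a 0 with ha0 | ha0
  · have : ∀ x, u x = 0 := fun x => le_antisymm (ha0 ▸ hua x) bot_le
    simp [this]
  rcases eq_or_ne b 0 with hb0 | hb0
  · have : ∀ x, v x = 0 := fun x => le_antisymm (hb0 ▸ hvb x) bot_le
    simp [this]
  obtain ⟨c, hc⟩ : ∃ c : ℝ≥0∞, c ^ 2 = a * b :=
    ⟨(a * b) ^ (1 / 2 : ℝ), by rw [← ENNReal.rpow_natCast, ← ENNReal.rpow_mul]; norm_num⟩
  have habT : a * b ≠ ⊤ := ENNReal.mul_ne_top haT hbT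
  have hab0 : a * b ≠ 0 := mul_ne_zero ha0 hb0
  have hcT : c ≠ ⊤ := by rintro rfl; simp at hc; exact habT hc.symm
  have hc0 : c ≠ 0 := by rintro rfl; simp at hc; rcases hc with h | h <;> contradiction
  have hu1 : ∀ x, u x / a ≤ 1 := fun x => ENNReal.div_le_of_le_mul (by simpa using hua x)
  have hv1 : ∀ x, v x / b ≤ 1 := fun x => ENNReal.div_le_of_le_mul (by simpa using hvb x)
  have hsup : ∀ (w : ℝ → ℝ≥0∞) (d : ℝ≥0∞), d = ⨆ x, w x → d ≠ 0 → d ≠ ⊤ → (∀ x, w x / d ≤ 1) →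
      ∀ t < (1 : ℝ), ∃ x, t < (w x / d).toReal := by
    intro w d hd hd0 hdT hw1 t ht
    rcases lt_or_ge t 0 with h0 | h0
    · exact ⟨0, h0.trans_le ENNReal.toReal_nonneg⟩
    have : ENNReal.ofReal t * d < d := by
      conv_rhs => rw [← one_mul d]
      exact ENNReal.mul_lt_mul_left hd0 hdT (by simpa using ht)
    conv_rhs at this => rw [hd]
    obtain ⟨x, hx⟩ := lt_iSup_iff.mp this
    refine ⟨x, ?_⟩
    rw [← ENNReal.ofReal_lt_iff_lt_toReal h0 (ne_top_of_le_ne_top ENNReal.one_ne_top (hw1 x))]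
    exact (ENNReal.lt_div_iff_mul_lt (Or.inl hd0) (Or.inl hdT)).mpr hx
  have hT : ∀ {r : ℝ≥0∞}, r ≤ 1 → r ≠ ⊤ := fun hr => ne_top_of_le_ne_top ENNReal.one_ne_top hr
  have hmul : ∀ x y, (u x / a) * (v y / b) ≤ (min 1 (h ((1 / 2 : ℝ) • (x + y)) / c)) ^ 2 := by
    intro x y
    rcases min_cases 1 (h ((1 / 2 : ℝ) • (x + y)) / c) with ⟨e, _⟩ | ⟨e, _⟩ <;> rw [e]
    · simpa using mul_le_mul' (hu1 x) (hv1 y)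
    · have : (u x / a) * (v y / b) = u x * v y / c ^ 2 := by
        rw [hc, div_eq_mul_inv, div_eq_mul_inv, div_eq_mul_inv,
          ENNReal.mul_inv (Or.inl ha0) (Or.inl haT)]
        ring
      rw [this, div_eq_mul_inv (h _), mul_pow, ← ENNReal.inv_pow, ← div_eq_mul_inv]
      exact ENNReal.div_le_div_right (huv x y) _
  have key := lintegral_add_lintegral_le_of_sup_one (u := fun x => (u x / a).toReal)
    (v := fun x => (v x / b).toReal) (h := fun x => (min 1 (h x / c)).toReal)
    (by fun_prop) (by fun_prop) (by fun_prop) (fun _ => ENNReal.toReal_nonneg)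
    (fun _ => ENNReal.toReal_nonneg) (fun _ => ENNReal.toReal_nonneg)
    (fun x => ENNReal.toReal_le_of_le_ofReal zero_le_one (by simpa using hu1 x))
    (fun x => ENNReal.toReal_le_of_le_ofReal zero_le_one (by simpa using hv1 x))
    (hsup u a ha ha0 haT hu1) (hsup v b hb hb0 hbT hv1)
    (fun x y => by
      rw [← ENNReal.toReal_mul, ← ENNReal.toReal_pow]
      exact ENNReal.toReal_mono (ENNReal.pow_ne_top (hT (min_le_left _ _))) (hmul x y))
  simp only [ENNReal.ofReal_toReal (hT (hu1 _)), ENNReal.ofReal_toReal (hT (hv1 _)),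
    ENNReal.ofReal_toReal (hT (min_le_left 1 _))] at key
  have key2 : (∫⁻ x, u x) / a + (∫⁻ x, v x) / b ≤ 2 * ((∫⁻ x, h x) / c) := by
    simp only [div_eq_mul_inv] at key ⊢
    rw [lintegral_mul_const _ hu, lintegral_mul_const _ hv] at key
    refine key.trans ?_
    rw [← lintegral_mul_const _ hh]
    gcongr
    exact min_le_right _ _
  have key3 : 4 * ((∫⁻ x, u x) / a * ((∫⁻ x, v x) / b)) ≤ 4 * ((∫⁻ x, h x) / c) ^ 2 := by
    refine (ENNReal.four_mul_le_add_sq _ _).trans ((pow_le_pow_left' key2 2).trans_eq ?_)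
    rw [mul_pow]; norm_num
  have key4 := (ENNReal.mul_le_mul_iff_right (by norm_num) (by norm_num)).mp key3
  have e1 : (∫⁻ x, u x) / a * ((∫⁻ x, v x) / b) = ((∫⁻ x, u x) * ∫⁻ x, v x) / c ^ 2 := by
    rw [hc, div_eq_mul_inv, div_eq_mul_inv, div_eq_mul_inv,
      ENNReal.mul_inv (Or.inl ha0) (Or.inl haT)]
    ring
  have e2 : ((∫⁻ x, h x) / c) ^ 2 = (∫⁻ x, h x) ^ 2 / c ^ 2 := by
    rw [div_eq_mul_inv, mul_pow, ← ENNReal.inv_pow, ← div_eq_mul_inv]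
  rw [e1, e2, ENNReal.div_le_iff (pow_ne_zero 2 hc0) (ENNReal.pow_ne_top hcT),
    ENNReal.div_mul_cancel (pow_ne_zero 2 hc0) (ENNReal.pow_ne_top hcT)] at key4
  exact key4

theorem lintegral_eq_iSup_lintegral_min {α : Type*} [MeasurableSpace α] {μ : Measure α}
    {u : α → ℝ≥0∞} (hu : Measurable u) :
    ∫⁻ x, u x ∂μ = ⨆ N : ℕ, ∫⁻ x, min (u x) N ∂μ := by
  rw [← lintegral_iSup (fun N => by fun_prop)
    (fun M N hMN x => by simp only; gcongr)]
  refine lintegral_congr fun x => ?_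
  change _ = ⨆ i : ℕ, u x ⊓ (i : ℝ≥0∞)
  rw [← inf_iSup_eq, ENNReal.iSup_natCast]
  simp

theorem midpointPrekopaLeindler_real : MidpointPrekopaLeindler (volume : Measure ℝ) := by
  intro u v h hu hv hh huv
  rw [lintegral_eq_iSup_lintegral_min hu, lintegral_eq_iSup_lintegral_min hv]
  simp only [ENNReal.iSup_mul, ENNReal.mul_iSup]
  refine iSup_le fun M => iSup_le fun N => ?_
  exact prekopaLeindler_real_of_bounded (by fun_prop) (by fun_prop) hh (ENNReal.natCast_ne_top _)
    (ENNReal.natCast_ne_top _) (fun x => min_le_right _ _) (fun x => min_le_right _ _)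
    fun x y => (mul_le_mul' (min_le_left _ _) (min_le_left _ _)).trans (huv x y)

/-- The fibres over `x`, `y` and their midpoint satisfy the hypothesis for `ν`, so the fibre
integrals satisfy it for `μ`. -/
theorem MidpointPrekopaLeindler.prod {α β : Type*} [AddCommGroup α] [Module ℝ α]
    [MeasurableSpace α] [AddCommGroup β] [Module ℝ β] [MeasurableSpace β]
    {μ : Measure α} {ν : Measure β} [SFinite ν] (hμ : MidpointPrekopaLeindler μ)
    (hν : MidpointPrekopaLeindler ν) : MidpointPrekopaLeindler (μ.prod ν) := by
  intro u v h hu hv hh huv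
  rw [lintegral_prod _ hu.aemeasurable, lintegral_prod _ hv.aemeasurable,
    lintegral_prod _ hh.aemeasurable]
  refine hμ _ _ _ hu.lintegral_prod_right' hv.lintegral_prod_right' hh.lintegral_prod_right' ?_
  intro x y
  exact hν _ _ _ (by fun_prop) (by fun_prop) (by fun_prop) fun s t => huv (x, s) (y, t)

theorem MidpointPrekopaLeindler.of_measurePreserving {α β : Type*} [AddCommGroup α] [Module ℝ α]
    [MeasurableSpace α] [AddCommGroup β] [Module ℝ β] [MeasurableSpace β]
    {μ : Measure α} {ν : Measure β} (hμ : MidpointPrekopaLeindler μ) (e : α → β)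
    (he : MeasurePreserving e μ ν)
    (hmid : ∀ x y, e ((1 / 2 : ℝ) • (x + y)) = (1 / 2 : ℝ) • (e x + e y)) :
    MidpointPrekopaLeindler ν := by
  intro u v h hu hv hh huv
  rw [← he.lintegral_comp hu, ← he.lintegral_comp hv, ← he.lintegral_comp hh]
  have := he.measurable
  refine hμ _ _ _ (by fun_prop) (by fun_prop) (by fun_prop) fun x y => ?_
  rw [hmid]
  exact huv _ _

theorem midpointPrekopaLeindler_pi (n : ℕ) :
    MidpointPrekopaLeindler (volume : Measure (Fin n → ℝ)) := by
  induction n with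
  | zero =>
    intro u v h hu hv hh huv
    rw [Measure.volume_pi_eq_dirac (default : Fin 0 → ℝ)]
    have := huv default default
    rw [Subsingleton.elim ((1 / 2 : ℝ) • (_ : Fin 0 → ℝ)) default] at this
    simpa only [lintegral_dirac] using this
  | succ n ih =>
    refine (midpointPrekopaLeindler_real.prod ih).of_measurePreserving
      (MeasurableEquiv.piFinSuccAbove (fun _ => ℝ) 0).symm
      (volume_preserving_piFinSuccAbove (fun _ : Fin (n + 1) => ℝ) 0).symm ?_
    intro x y
    ext i
    refine Fin.cases ?_ (fun j => ?_) i <;>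
      simp [MeasurableEquiv.piFinSuccAbove, Fin.insertNthEquiv, mul_add]

theorem midpointPrekopaLeindler_euclideanSpace (n : ℕ) :
    MidpointPrekopaLeindler (volume : Measure (EuclideanSpace ℝ (Fin n))) :=
  (midpointPrekopaLeindler_pi n).of_measurePreserving _ (PiLp.volume_preserving_toLp (Fin n))
    fun _ _ => rfl

/-! ### The inverse quadratic form and its dual description -/

/-- The quadratic form `vᵀ A⁻¹ v` of the inverse of a real matrix. -/
noncomputable def realInvForm {n : ℕ} (A : Matrix (Fin n) (Fin n) ℝ) (v : Fin n → ℝ) : ℝ :=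
  v ⬝ᵥ (A⁻¹ *ᵥ v)

theorem invForm_re {n : ℕ} (A : Matrix (Fin n) (Fin n) ℝ) (v : Fin n → ℂ) :
    (invForm A v).re = realInvForm A (fun j => (v j).re) + realInvForm A (fun j => (v j).im) := by
  simp only [invForm, realInvForm, dotProduct, Matrix.mulVec, Matrix.map_apply, Complex.re_sum,
    Finset.mul_sum, ← Finset.sum_add_distrib]
  refine Finset.sum_congr rfl fun j _ => Finset.sum_congr rfl fun k _ => ?_
  simp

theorem Matrix.PosDef.dotProduct_mulVec_comm {n : ℕ} {A : Matrix (Fin n) (Fin n) ℝ}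
    (hA : A.PosDef) (u w : Fin n → ℝ) : u ⬝ᵥ (A *ᵥ w) = w ⬝ᵥ (A *ᵥ u) := by
  have hT : Aᵀ = A := by simpa [Matrix.IsHermitian] using hA.isHermitian
  rw [Matrix.dotProduct_mulVec, ← Matrix.mulVec_transpose, hT, dotProduct_comm]

theorem Matrix.PosDef.mulVec_inv_mulVec {n : ℕ} {A : Matrix (Fin n) (Fin n) ℝ}
    (hA : A.PosDef) (v : Fin n → ℝ) : A *ᵥ (A⁻¹ *ᵥ v) = v := by
  rw [Matrix.mulVec_mulVec, Matrix.mul_nonsing_inv _ hA.det_pos.ne'.isUnit, Matrix.one_mulVec]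

theorem realInvForm_nonneg {n : ℕ} {A : Matrix (Fin n) (Fin n) ℝ} (hA : A.PosDef)
    (v : Fin n → ℝ) : 0 ≤ realInvForm A v := by
  simpa [realInvForm] using hA.inv.posSemidef.dotProduct_mulVec_nonneg v

/-- Complete the square: with `v = A u`, the form `A` is nonnegative at `s w - u`. Together with
equality at `w = A⁻¹ v` for `s = 1`, this exhibits the inverse form as a supremum. -/
theorem two_mul_dotProduct_sub_le {n : ℕ} {A : Matrix (Fin n) (Fin n) ℝ} (hA : A.PosDef)
    {s : ℝ} (hs : 0 < s) (v w : Fin n → ℝ) :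
    2 * (v ⬝ᵥ w) - s * (w ⬝ᵥ (A *ᵥ w)) ≤ realInvForm A v / s := by
  obtain ⟨u, rfl⟩ : ∃ u, v = A *ᵥ u := ⟨_, (hA.mulVec_inv_mulVec v).symm⟩
  have hq : realInvForm A (A *ᵥ u) = u ⬝ᵥ (A *ᵥ u) := by
    rw [realInvForm, Matrix.mulVec_mulVec, Matrix.nonsing_inv_mul _ hA.det_pos.ne'.isUnit,
      Matrix.one_mulVec, dotProduct_comm]
  have h0 : 0 ≤ (s • w - u) ⬝ᵥ (A *ᵥ (s • w - u)) := by
    simpa using hA.posSemidef.dotProduct_mulVec_nonneg (s • w - u)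
  have h1 := hA.dotProduct_mulVec_comm u w
  simp only [Matrix.mulVec_sub, Matrix.mulVec_smul, dotProduct_sub, sub_dotProduct,
    smul_dotProduct, dotProduct_smul, smul_eq_mul] at h0
  rw [hq, le_div_iff₀ hs, dotProduct_comm]
  nlinarith

theorem two_mul_dotProduct_sub_eq {n : ℕ} {A : Matrix (Fin n) (Fin n) ℝ} (hA : A.PosDef)
    (v : Fin n → ℝ) :
    2 * (v ⬝ᵥ (A⁻¹ *ᵥ v)) - (A⁻¹ *ᵥ v) ⬝ᵥ (A *ᵥ (A⁻¹ *ᵥ v)) = realInvForm A v := by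
  rw [hA.mulVec_inv_mulVec, dotProduct_comm (A⁻¹ *ᵥ v), realInvForm]
  ring

/-! ### Hessian calculus and local uniform convexity -/

section Hessian

variable {n : ℕ} {Φ : EuclideanSpace ℝ (Fin n) → ℝ}

theorem hessian_apply (hΦ : ContDiff ℝ 2 Φ) (x : EuclideanSpace ℝ (Fin n)) (j k : Fin n) :
    hessian Φ x j k = fderiv ℝ (fderiv ℝ Φ) x (EuclideanSpace.single j 1)
      (EuclideanSpace.single k 1) := by
  have h1 : DifferentiableAt ℝ (fderiv ℝ Φ) x :=
    ((hΦ.fderiv_right (m := 1) (by norm_num)).differentiable (by norm_num)) x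
  simp only [hessian, partialDeriv, Matrix.of_apply]
  change fderiv ℝ (fun y => fderiv ℝ Φ y (EuclideanSpace.single k 1)) x _ = _
  rw [fderiv_clm_apply h1 (by fun_prop)]
  simp

theorem continuous_fderiv_fderiv (hΦ : ContDiff ℝ 2 Φ) : Continuous (fderiv ℝ (fderiv ℝ Φ)) :=
  (hΦ.fderiv_right (m := 1) (by norm_num)).continuous_fderiv (by norm_num)

theorem continuous_hessian_apply (hΦ : ContDiff ℝ 2 Φ) (j k : Fin n) :
    Continuous fun x => hessian Φ x j k := by
  simp only [hessian_apply hΦ]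
  have h1 := continuous_fderiv_fderiv hΦ
  fun_prop

theorem continuous_hessian (hΦ : ContDiff ℝ 2 Φ) : Continuous (hessian Φ) :=
  continuous_matrix fun j k => continuous_hessian_apply hΦ j k

theorem EuclideanSpace.eq_sum_single (w : EuclideanSpace ℝ (Fin n)) :
    w = ∑ j, w j • EuclideanSpace.single j (1 : ℝ) := by
  ext i
  simp [Finset.sum_apply, Pi.single_apply]

theorem clm_apply_eq_dotProduct (L : EuclideanSpace ℝ (Fin n) →L[ℝ] ℝ)
    (w : EuclideanSpace ℝ (Fin n)) :
    L w = (fun j => L (EuclideanSpace.single j 1)) ⬝ᵥ w.ofLp := by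
  conv_lhs => rw [EuclideanSpace.eq_sum_single w]
  simp [dotProduct, mul_comm]

theorem fderiv_fderiv_apply_eq (hΦ : ContDiff ℝ 2 Φ) (x w : EuclideanSpace ℝ (Fin n)) :
    fderiv ℝ (fderiv ℝ Φ) x w w = w.ofLp ⬝ᵥ (hessian Φ x *ᵥ w.ofLp) := by
  conv_lhs => rw [EuclideanSpace.eq_sum_single w]
  simp only [map_sum, map_smul, sum_apply, smul_apply,
    ← hessian_apply hΦ, smul_eq_mul, dotProduct, Matrix.mulVec, Finset.mul_sum]
  rw [Finset.sum_comm]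
  refine Finset.sum_congr rfl fun j _ => Finset.sum_congr rfl fun k _ => by ring

theorem hessian_posDef (hΦ : ContDiff ℝ 2 Φ)
    (hconv : ∀ (x : EuclideanSpace ℝ (Fin n)) (z : Fin n → ℂ), z ≠ 0 →
      0 < ∑ j, ∑ k, (hessian Φ x j k : ℂ) * z j * conj (z k))
    (x : EuclideanSpace ℝ (Fin n)) : (hessian Φ x).PosDef := by
  refine Matrix.PosDef.of_dotProduct_mulVec_pos ?_ fun v hv => ?_
  · ext j k
    rw [Matrix.conjTranspose_apply, star_trivial, hessian_apply hΦ, hessian_apply hΦ]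
    exact (hΦ.contDiffAt.isSymmSndFDerivAt (by simp)).eq _ _
  -- Positivity on complex vectors is needed only at real ones.
  · have h := hconv x (fun j => (v j : ℂ)) (by
      contrapose! hv
      ext j
      simpa using congrFun hv j)
    have e : ∑ j, ∑ k, (hessian Φ x j k : ℂ) * (v j : ℂ) * conj (v k : ℂ) =
        ((star v ⬝ᵥ (hessian Φ x *ᵥ v) : ℝ) : ℂ) := by
      simp only [dotProduct, Matrix.mulVec, Finset.mul_sum, Complex.ofReal_sum]
      refine Finset.sum_congr rfl fun j _ => Finset.sum_congr rfl fun k _ => ?_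
      simp
      ring
    rw [e] at h
    exact_mod_cast h

/-- The form has a positive minimum on the compact set `K × sphere`. This local bound stands in for
a global lower bound on the Hessian. -/
theorem exists_pos_mul_sq_le_fderiv_fderiv (hΦ : ContDiff ℝ 2 Φ)
    (hpos : ∀ x, (hessian Φ x).PosDef) {K : Set (EuclideanSpace ℝ (Fin n))} (hK : IsCompact K) :
    ∃ m > 0, ∀ x ∈ K, ∀ w, m * ‖w‖ ^ 2 ≤ fderiv ℝ (fderiv ℝ Φ) x w w := by
  have hcont := continuous_fderiv_fderiv hΦ
  obtain ⟨m, hm, h⟩ := (hK.prod (isCompact_sphere (0 : EuclideanSpace ℝ (Fin n)) 1)).exists_forall_le'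
    (f := fun p => fderiv ℝ (fderiv ℝ Φ) p.1 p.2 p.2) (by fun_prop) (a := 0) (by
      rintro ⟨x, w⟩ ⟨-, hw⟩
      have hw0 : w ≠ 0 := by rintro rfl; simp at hw
      rw [fderiv_fderiv_apply_eq hΦ]
      simpa using (hpos x).dotProduct_mulVec_pos (x := w.ofLp) (by simpa using hw0))
  refine ⟨m, hm, fun x hx w => ?_⟩
  rcases eq_or_ne w 0 with rfl | hw
  · simp
  have hw' : ‖w‖ ≠ 0 := norm_ne_zero_iff.mpr hw
  have := h (x, ‖w‖⁻¹ • w) ⟨hx, by simp [norm_smul, hw']⟩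
  simp only [map_smul, smul_apply, smul_eq_mul] at this
  calc m * ‖w‖ ^ 2 ≤ (‖w‖⁻¹ * (‖w‖⁻¹ * fderiv ℝ (fderiv ℝ Φ) x w w)) * ‖w‖ ^ 2 := by gcongr
    _ = _ := by field_simp

theorem continuous_realInvForm (hΦ : ContDiff ℝ 2 Φ) (hpos : ∀ x, (hessian Φ x).PosDef)
    {X : Type*} [TopologicalSpace X] {y : X → EuclideanSpace ℝ (Fin n)} {v : X → Fin n → ℝ}
    (hy : Continuous y) (hv : Continuous v) :
    Continuous fun x => realInvForm (hessian Φ (y x)) (v x) := by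
  have hinv : Continuous fun x => (hessian Φ (y x))⁻¹ := by
    simp only [Matrix.inv_def, Ring.inverse_eq_inv']
    have h := (continuous_hessian hΦ).comp hy
    exact (h.matrix_det.inv₀ fun x => (hpos _).det_pos.ne').smul h.matrix_adjugate
  exact hv.dotProduct (hinv.matrix_mulVec hv)

end Hessian

/-! ### The midpoint hypothesis for the perturbed densities -/

section Midpoint

variable {n : ℕ} {Φ : EuclideanSpace ℝ (Fin n) → ℝ}

/-- The function `s ↦ Φ (z + s w) - c s² / 2` is convex on `[-1, 1]`; compare its value at 0 with
those at the endpoints. -/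
theorem le_second_difference {E : Type*} [NormedAddCommGroup E] [NormedSpace ℝ E] {Φ : E → ℝ}
    (hΦ : ContDiff ℝ 2 Φ) {z w : E} {c : ℝ}
    (hc : ∀ s ∈ Set.Icc (-1 : ℝ) 1, c ≤ fderiv ℝ (fderiv ℝ Φ) (z + s • w) w w) :
    c ≤ Φ (z + w) + Φ (z - w) - 2 * Φ z := by
  have hl : ∀ s : ℝ, HasDerivAt (fun s : ℝ => z + s • w) w s := fun s => by
    simpa using ((hasDerivAt_id' s).smul_const w).const_add z
  have h1 : ∀ s : ℝ, HasDerivAt (fun s : ℝ => Φ (z + s • w) - c / 2 * s ^ 2)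
      (fderiv ℝ Φ (z + s • w) w - c * s) s := fun s => by
    have hd : HasFDerivAt Φ (fderiv ℝ Φ (z + s • w)) (z + s • w) :=
      (hΦ.differentiable (by norm_num) _).hasFDerivAt
    have hp : HasDerivAt (fun s : ℝ => c / 2 * s ^ 2) (c * s) s := by
      refine ((hasDerivAt_pow 2 s).const_mul (c / 2)).congr_deriv ?_
      norm_num
      ring
    exact (hd.comp_hasDerivAt s (hl s)).fun_sub hp
  have h2 : ∀ s : ℝ, HasDerivAt (fun s : ℝ => fderiv ℝ Φ (z + s • w) w - c * s)
      (fderiv ℝ (fderiv ℝ Φ) (z + s • w) w w - c) s := fun s => by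
    have hd : HasFDerivAt (fderiv ℝ Φ) (fderiv ℝ (fderiv ℝ Φ) (z + s • w)) (z + s • w) :=
      ((hΦ.fderiv_right (m := 1) (by norm_num)).differentiable (by norm_num) _).hasFDerivAt
    have hp : HasDerivAt (fun s : ℝ => c * s) c s := hasDerivAt_const_mul c
    have hq : HasDerivAt (fun s : ℝ => fderiv ℝ Φ (z + s • w) w)
        (fderiv ℝ (fderiv ℝ Φ) (z + s • w) w w) s :=
      (ContinuousLinearMap.apply ℝ ℝ w).hasFDerivAt.comp_hasDerivAt s
        (hd.comp_hasDerivAt s (hl s))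
    exact hq.fun_sub hp
  have hconv : ConvexOn ℝ (Set.Icc (-1 : ℝ) 1) fun s : ℝ => Φ (z + s • w) - c / 2 * s ^ 2 :=
    convexOn_of_hasDerivWithinAt2_nonneg (convex_Icc _ _)
      (fun s _ => (h1 s).continuousAt.continuousWithinAt)
      (fun s _ => (h1 s).hasDerivWithinAt) (fun s _ => (h2 s).hasDerivWithinAt)
      fun s hs => sub_nonneg.mpr (hc s (interior_subset hs))
  have h11 : (-1 : ℝ) ∈ Set.Icc (-1 : ℝ) 1 := by simp
  have h12 : (1 : ℝ) ∈ Set.Icc (-1 : ℝ) 1 := by simp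
  have := And.right hconv h11 h12 (by norm_num : (0 : ℝ) ≤ 1 / 2) (by norm_num : (0 : ℝ) ≤ 1 / 2)
    (by norm_num)
  norm_num [← sub_eq_add_neg] at this
  linarith

theorem IsCompact.exists_norm_sub_lt_of_continuous {X Y : Type*} [SeminormedAddCommGroup X]
    [SeminormedAddCommGroup Y] {K : Set X} (hK : IsCompact K) {F : X → Y} (hF : Continuous F)
    {ρ : ℝ} (hρ : 0 < ρ) : ∃ δ > 0, ∀ x ∈ K, ∀ t, ‖x - t‖ < δ → ‖F x - F t‖ < ρ := by
  have := hK.uniformContinuousAt_of_continuousAt F (fun x _ => hF.continuousAt)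
    (Metric.dist_mem_uniformity hρ)
  obtain ⟨δ, hδ, h⟩ := Metric.mem_uniformity_dist.mp this
  simp only [dist_eq_norm] at h
  refine ⟨δ, hδ, fun x hx t hxt => ?_⟩
  have := h hxt hx
  simpa [dist_eq_norm] using this

/-- If `‖w‖` is large compared with `ε`, convexity of `Φ` alone beats the oscillation of `f`.
Otherwise `‖w‖ ≤ C ε`, so the Taylor errors are a small multiple of `ε²`, absorbed by `η`. -/
theorem midpoint_le (hΦ : ContDiff ℝ 2 Φ) (hpos : ∀ x, (hessian Φ x).PosDef)
    {K : Set (EuclideanSpace ℝ (Fin n))} (hK : IsCompact K) (hKc : Convex ℝ K)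
    {f : EuclideanSpace ℝ (Fin n) → ℝ} (hf : ContDiff ℝ 1 f) {η : ℝ} (hη : 0 < η) :
    ∃ ε₀ > 0, ∀ ε, 0 < ε → ε < ε₀ → ∀ x ∈ K, ∀ y ∈ K,
      (-Φ x + ε * f x) + (-Φ y - ε * f y) ≤
        2 * (-Φ ((1 / 2 : ℝ) • (x + y)) + ε ^ 2 / 2 *
          (realInvForm (hessian Φ ((1 / 2 : ℝ) • (x + y)))
            (fun j => partialDeriv j f ((1 / 2 : ℝ) • (x + y))) + η)) := by
  obtain ⟨m, hm, hmK⟩ := exists_pos_mul_sq_le_fderiv_fderiv hΦ hpos hK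
  have hf' : Continuous (fderiv ℝ f) := hf.continuous_fderiv (by norm_num)
  have hfd : Differentiable ℝ f := hf.differentiable (by norm_num)
  obtain ⟨L₀, hL₀⟩ := hK.exists_bound_of_continuousOn hf'.continuousOn
  -- The maximum with 1 keeps `L`, hence `C` and `ρ`, positive even when the gradient vanishes. The
  -- value of `ρ` makes the total error `ρ (C ε)² + 2 ε ρ (C ε)` equal to `ε² η`.
  set L := max L₀ 1 with hL
  have hLpos : 0 < L := lt_max_of_lt_right one_pos
  have hLK : ∀ x ∈ K, ‖fderiv ℝ f x‖ ≤ L := fun x hx => (hL₀ x hx).trans (le_max_left _ _)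
  set C := 2 * L / m with hC
  have hCpos : 0 < C := by positivity
  set ρ := η / (C ^ 2 + 2 * C) with hρdef
  have hρ : 0 < ρ := by positivity
  obtain ⟨δ₁, hδ₁, h₁⟩ := hK.exists_norm_sub_lt_of_continuous
    (F := fderiv ℝ (fderiv ℝ Φ)) (continuous_fderiv_fderiv hΦ) hρ
  obtain ⟨δ₂, hδ₂, h₂⟩ := hK.exists_norm_sub_lt_of_continuous hf' hρ
  refine ⟨min δ₁ δ₂ / C, by positivity, fun ε hε hε₀ x hx y hy => ?_⟩
  set z := (1 / 2 : ℝ) • (x + y) with hz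
  set w := (1 / 2 : ℝ) • (x - y) with hw
  have hxe : x = z + w := by rw [hz, hw]; module
  have hye : y = z - w := by rw [hz, hw]; module
  have hseg : ∀ s ∈ Set.Icc (-1 : ℝ) 1, z + s • w ∈ K := by
    intro s hs
    have := hKc hx hy (a := (1 + s) / 2) (b := (1 - s) / 2) (by linarith [hs.1])
      (by linarith [hs.2]) (by ring)
    convert this using 1
    rw [hz, hw]; module
  have hzK : z ∈ K := by simpa using hseg 0 (by simp)
  set v : Fin n → ℝ := fun j => partialDeriv j f z with hv
  have hq : 0 ≤ realInvForm (hessian Φ z) v := realInvForm_nonneg (hpos z) v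
  have hxy : x - y = (2 : ℝ) • w := by rw [hw]; module
  rcases le_or_gt (2 * L * ε) (m * ‖w‖) with hbig | hsmall
  · have hD : m * ‖w‖ ^ 2 ≤ Φ (z + w) + Φ (z - w) - 2 * Φ z :=
      le_second_difference hΦ fun s hs => hmK _ (hseg s hs) w
    rw [← hxe, ← hye] at hD
    have hF : ‖f x - f y‖ ≤ L * ‖x - y‖ :=
      hKc.norm_image_sub_le_of_norm_fderiv_le (fun p _ => hfd p) hLK hy hx
    rw [hxy, norm_smul, Real.norm_ofNat] at hF
    have hF' := (le_abs_self _).trans hF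
    have h3 : 0 ≤ ε ^ 2 * (realInvForm (hessian Φ z) v + η) := by positivity
    have h4 : ε * (f x - f y) ≤ ε * (L * (2 * ‖w‖)) := by gcongr
    have h5 : ε * (L * (2 * ‖w‖)) ≤ m * ‖w‖ ^ 2 := by nlinarith [norm_nonneg w]
    linarith
  · have hwC : ‖w‖ ≤ C * ε := by
      rw [hC, div_mul_eq_mul_div, le_div_iff₀ hm]; linarith
    have hδ : C * ε < min δ₁ δ₂ := by
      rw [lt_div_iff₀ hCpos] at hε₀; linarith
    have hw1 : ‖w‖ < δ₁ := hwC.trans_lt (hδ.trans_le (min_le_left _ _))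
    have hw2 : ‖w‖ < δ₂ := hwC.trans_lt (hδ.trans_le (min_le_right _ _))
    have hD : fderiv ℝ (fderiv ℝ Φ) z w w - ρ * ‖w‖ ^ 2 ≤
        Φ (z + w) + Φ (z - w) - 2 * Φ z := by
      refine le_second_difference hΦ fun s hs => ?_
      have hs' : ‖s • w‖ ≤ ‖w‖ := by
        rw [norm_smul]
        exact mul_le_of_le_one_left (norm_nonneg _) (abs_le.mpr hs)
      have hd := h₁ z hzK (z + s • w) (by simpa using hs'.trans_lt hw1)
      have hle := ContinuousLinearMap.le_opNorm₂ (fderiv ℝ (fderiv ℝ Φ) z -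
        fderiv ℝ (fderiv ℝ Φ) (z + s • w)) w w
      have hle' := (le_abs_self _).trans hle
      simp only [sub_apply] at hle'
      have : ‖fderiv ℝ (fderiv ℝ Φ) z - fderiv ℝ (fderiv ℝ Φ) (z + s • w)‖ * ‖w‖ * ‖w‖ ≤
        ρ * ‖w‖ * ‖w‖ := by gcongr
      nlinarith
    rw [← hxe, ← hye] at hD
    have hF : ‖f x - f y - fderiv ℝ f z (x - y)‖ ≤ ρ * ‖x - y‖ := by
      refine (convex_ball z δ₂).norm_image_sub_le_of_norm_fderiv_le' (fun p _ => hfd p)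
        (fun p hp => ?_) ?_ ?_
      · have := h₂ z hzK p (by rwa [← dist_eq_norm, dist_comm])
        rw [norm_sub_rev] at this
        exact this.le
      · rw [hye]; simpa using hw2
      · rw [hxe]; simpa using hw2
    rw [hxy, norm_smul, Real.norm_ofNat, map_smul, smul_eq_mul] at hF
    have hF' := (le_abs_self _).trans hF
    -- Duality with `s = ε⁻¹`; multiplying by `ε` then gives the bound `ε² q(z)`.
    have hdual := two_mul_dotProduct_sub_le (hpos z) (inv_pos.mpr hε) v w.ofLp
    rw [← fderiv_fderiv_apply_eq hΦ, show v ⬝ᵥ w.ofLp = fderiv ℝ f z w from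
      (clm_apply_eq_dotProduct (fderiv ℝ f z) w).symm, div_inv_eq_mul,
      inv_mul_eq_div] at hdual
    have hdual' : 2 * ε * fderiv ℝ f z w - fderiv ℝ (fderiv ℝ Φ) z w w ≤
        ε ^ 2 * realInvForm (hessian Φ z) v := by
      have := mul_le_mul_of_nonneg_left hdual hε.le
      rw [mul_sub, mul_div_cancel₀ _ hε.ne'] at this
      linarith
    have h4 : ε * (f x - f y - 2 * fderiv ℝ f z w) ≤ ε * (ρ * (2 * ‖w‖)) := by gcongr
    have h5 : ρ * ‖w‖ ^ 2 + ε * (ρ * (2 * ‖w‖)) ≤ ρ * (C * ε) ^ 2 + ε * (ρ * (2 * (C * ε))) := by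
      gcongr
    have h6 : ρ * (C * ε) ^ 2 + ε * (ρ * (2 * (C * ε))) = ε ^ 2 * η := by
      rw [hρdef]; field_simp
    linarith

end Midpoint

/-! ### Extracting the variance from exponential integrals -/

theorem le_two_mul_mul_of_forall_small {Z V P D : NNReal} {δ₀ : ℝ} (hδ₀ : 0 < δ₀)
    (h : ∀ δ : NNReal, 0 < δ → (δ : ℝ) < δ₀ →
      2 * Z ^ 2 + δ * V ≤ 2 * (Z + δ / 2 * P + δ ^ 2 * D) ^ 2) :
    V ≤ 2 * Z * P := by
  have h' : ∀ᶠ δ : ℝ in 𝓝[>] 0, (V : ℝ) ≤ 2 * Z * P + 4 * Z * D * δ + 2 * δ * (P / 2 + δ * D) ^ 2 := by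
    filter_upwards [Ioo_mem_nhdsGT hδ₀] with δ hδ
    have := h ⟨δ, hδ.1.le⟩ hδ.1 hδ.2
    have h2 : 2 * (Z : ℝ) ^ 2 + δ * V ≤ 2 * (Z + δ / 2 * P + δ ^ 2 * D) ^ 2 := by
      exact_mod_cast this
    have h3 : δ * V ≤ δ * (2 * Z * P + 4 * Z * D * δ + 2 * δ * (P / 2 + δ * D) ^ 2) := by
      nlinarith
    exact le_of_mul_le_mul_left h3 hδ.1
  have hlim : Tendsto (fun δ : ℝ => 2 * Z * P + 4 * Z * D * δ + 2 * δ * (P / 2 + δ * D) ^ 2)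
      (𝓝[>] (0 : ℝ)) (𝓝 (2 * Z * P : ℝ)) := by
    have : Continuous fun δ : ℝ => 2 * Z * P + 4 * Z * D * δ + 2 * δ * ((P : ℝ) / 2 + δ * D) ^ 2 := by
      fun_prop
    simpa using (this.tendsto 0).mono_left nhdsWithin_le_nhds
  have := ge_of_tendsto hlim h'
  exact_mod_cast this

/-- The difference of the exponential sum and 2 is `4 sinh² (t / 2)`, and `sinh s ≥ s` for `s ≥ 0`.
-/
theorem two_add_sq_le_exp_add_exp_neg (t : ℝ) : 2 + t ^ 2 ≤ Real.exp t + Real.exp (-t) := by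
  wlog ht : 0 ≤ t generalizing t
  · have := this (-t) (by linarith)
    rw [neg_neg] at this
    linarith [neg_sq t]
  have h := Real.self_le_sinh_iff.mpr (by linarith : 0 ≤ t / 2)
  rw [Real.sinh_eq] at h
  have e1 : Real.exp t = Real.exp (t / 2) ^ 2 := by rw [← Real.exp_nat_mul]; ring_nf
  have e2 : Real.exp (-t) = Real.exp (-(t / 2)) ^ 2 := by rw [← Real.exp_nat_mul]; ring_nf
  have e3 : Real.exp (t / 2) * Real.exp (-(t / 2)) = 1 := by rw [← Real.exp_add]; simp
  rw [e1, e2]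
  nlinarith

section FiniteMeasure

variable {α : Type*} [MeasurableSpace α] {ν : Measure α}

/-- Writing the product as a double integral in both orders produces `exp t + exp (-t)` with `t = ε
(f x - f y)`. -/
theorem two_mul_sq_add_le_lintegral_exp_mul [SFinite ν] {f : α → ℝ} (hf : Measurable f) (ε : ℝ) :
    2 * ν Set.univ ^ 2 +
        ENNReal.ofReal (ε ^ 2) * ∫⁻ z, ENNReal.ofReal ((f z.1 - f z.2) ^ 2) ∂(ν.prod ν) ≤
      2 * ((∫⁻ x, ENNReal.ofReal (Real.exp (ε * f x)) ∂ν) *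
        ∫⁻ x, ENNReal.ofReal (Real.exp (-(ε * f x))) ∂ν) := by
  have e1 := lintegral_prod_mul (μ := ν) (ν := ν)
    (f := fun x => ENNReal.ofReal (Real.exp (ε * f x)))
    (g := fun x => ENNReal.ofReal (Real.exp (-(ε * f x)))) (by fun_prop) (by fun_prop)
  have e2 := lintegral_prod_mul (μ := ν) (ν := ν)
    (f := fun x => ENNReal.ofReal (Real.exp (-(ε * f x))))
    (g := fun x => ENNReal.ofReal (Real.exp (ε * f x))) (by fun_prop) (by fun_prop)
  have e3 : 2 * ν Set.univ ^ 2 = ∫⁻ z, ENNReal.ofReal 2 ∂(ν.prod ν) := by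
    rw [lintegral_const, ← Set.univ_prod_univ, Measure.prod_prod]
    norm_num [sq]
  rw [two_mul (_ * _)]
  nth_rewrite 4 [mul_comm]
  rw [← e1, ← e2, e3, ← lintegral_const_mul _ (by fun_prop), ← lintegral_add_left (by fun_prop),
    ← lintegral_add_left (by fun_prop)]
  refine lintegral_mono fun z => ?_
  simp only
  rw [← ENNReal.ofReal_mul (by positivity), ← ENNReal.ofReal_mul (by positivity),
    ← ENNReal.ofReal_mul (by positivity), ← ENNReal.ofReal_add (by positivity) (by positivity),
    ← ENNReal.ofReal_add (by positivity) (by positivity), ← Real.exp_add, ← Real.exp_add]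
  refine ENNReal.ofReal_le_ofReal ?_
  have := two_add_sq_le_exp_add_exp_neg (ε * (f z.1 - f z.2))
  convert this using 2
  · ring
  · ring_nf
  · ring_nf

theorem lintegral_exp_mul_le {p : α → ℝ} (hp : Measurable p) {B : ℝ}
    (hp0 : ∀ᵐ x ∂ν, 0 ≤ p x) (hpB : ∀ᵐ x ∂ν, p x ≤ B) {δ : NNReal} (hδ : δ * B ≤ 1) :
    ∫⁻ x, ENNReal.ofReal (Real.exp (δ / 2 * p x)) ∂ν ≤
      ν Set.univ + δ / 2 * (∫⁻ x, ENNReal.ofReal (p x) ∂ν) +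
        δ ^ 2 * (ENNReal.ofReal (B ^ 2) * ν Set.univ) := by
  have e : ν Set.univ + (δ : ℝ≥0∞) / 2 * (∫⁻ x, ENNReal.ofReal (p x) ∂ν) +
        (δ : ℝ≥0∞) ^ 2 * (ENNReal.ofReal (B ^ 2) * ν Set.univ) =
      ∫⁻ x, (1 + (δ : ℝ≥0∞) / 2 * ENNReal.ofReal (p x) + (δ : ℝ≥0∞) ^ 2 * ENNReal.ofReal (B ^ 2)) ∂ν := by
    rw [lintegral_add_right _ (by fun_prop), lintegral_add_left (by fun_prop),
      lintegral_const_mul _ (by fun_prop), lintegral_const, lintegral_const]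
    ring
  rw [e]
  refine lintegral_mono_ae ?_
  filter_upwards [hp0, hpB] with x h0 hB
  have e1 : (δ : ℝ≥0∞) / 2 = ENNReal.ofReal ((δ : ℝ) / 2) := by
    rw [ENNReal.ofReal_div_of_pos (by norm_num)]; simp
  have e2 : (δ : ℝ≥0∞) ^ 2 = ENNReal.ofReal ((δ : ℝ) ^ 2) := by
    rw [ENNReal.ofReal_pow (by positivity)]; simp
  rw [e1, e2, ← ENNReal.ofReal_one, ← ENNReal.ofReal_mul (by positivity),
    ← ENNReal.ofReal_mul (by positivity), ← ENNReal.ofReal_add (by positivity) (by positivity),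
    ← ENNReal.ofReal_add (by positivity) (by positivity)]
  refine ENNReal.ofReal_le_ofReal ?_
  have hδ0 : (0 : ℝ) ≤ δ := δ.2
  have ht0 : 0 ≤ δ / 2 * p x := by positivity
  have htB : δ / 2 * p x ≤ δ * B := by nlinarith [mul_le_mul_of_nonneg_left hB hδ0]
  have h1 := (abs_le.mp (Real.abs_exp_sub_one_sub_id_le (x := δ / 2 * p x)
    (abs_le.mpr ⟨by linarith, by linarith⟩))).2
  have h2 : (δ / 2 * p x) ^ 2 ≤ (δ * B) ^ 2 := by gcongr
  rw [mul_pow] at h2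
  linarith

/-- With `δ = ε²`, both sides have the same constant term, and the coefficients of `δ` give the
claim. -/
theorem lintegral_sq_sub_le_of_forall_exp [IsFiniteMeasure ν] {f p : α → ℝ} (hf : Measurable f) (hp : Measurable p)
    {B : ℝ} (hp0 : ∀ᵐ x ∂ν, 0 ≤ p x) (hpB : ∀ᵐ x ∂ν, p x ≤ B) {ε₀ : ℝ} (hε₀ : 0 < ε₀)
    (h : ∀ ε, 0 < ε → ε < ε₀ → (∫⁻ x, ENNReal.ofReal (Real.exp (ε * f x)) ∂ν) *
        ∫⁻ x, ENNReal.ofReal (Real.exp (-(ε * f x))) ∂ν ≤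
      (∫⁻ x, ENNReal.ofReal (Real.exp (ε ^ 2 / 2 * p x)) ∂ν) ^ 2) :
    ∫⁻ z, ENNReal.ofReal ((f z.1 - f z.2) ^ 2) ∂(ν.prod ν) ≤
      2 * ν Set.univ * ∫⁻ x, ENNReal.ofReal (p x) ∂ν := by
  have hZ : ν Set.univ ≠ ⊤ := measure_ne_top _ _
  have hP : ∫⁻ x, ENNReal.ofReal (p x) ∂ν ≠ ⊤ := by
    refine ne_top_of_le_ne_top (b := ∫⁻ x, ENNReal.ofReal B ∂ν) ?_ (lintegral_mono_ae ?_)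
    · rw [lintegral_const]; exact ENNReal.mul_ne_top ENNReal.ofReal_ne_top hZ
    · filter_upwards [hpB] with x hx using ENNReal.ofReal_le_ofReal hx
  have hD : ENNReal.ofReal (B ^ 2) * ν Set.univ ≠ ⊤ := ENNReal.mul_ne_top ENNReal.ofReal_ne_top hZ
  set δ₀ := min (ε₀ ^ 2) (1 / (|B| + 1)) with hδ₀
  have hδ₀pos : 0 < δ₀ := by positivity
  have key : ∀ δ : NNReal, 0 < δ → (δ : ℝ) < δ₀ →
      2 * ν Set.univ ^ 2 + δ * ∫⁻ z, ENNReal.ofReal ((f z.1 - f z.2) ^ 2) ∂(ν.prod ν) ≤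
      2 * (ν Set.univ + δ / 2 * (∫⁻ x, ENNReal.ofReal (p x) ∂ν) +
        δ ^ 2 * (ENNReal.ofReal (B ^ 2) * ν Set.univ)) ^ 2 := by
    intro δ hδ hδlt
    have hδB : δ * B ≤ 1 := by
      have h1 : (δ : ℝ) * (|B| + 1) < 1 := by
        have := hδlt.trans_le (min_le_right _ _)
        rwa [lt_div_iff₀ (by positivity)] at this
      have h2 : (δ : ℝ) * B ≤ δ * |B| := mul_le_mul_of_nonneg_left (le_abs_self B) δ.2
      have h3 : (0 : ℝ) ≤ δ := δ.2
      linarith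
    have hs : Real.sqrt δ ^ 2 = δ := Real.sq_sqrt δ.2
    have h1 := two_mul_sq_add_le_lintegral_exp_mul (ν := ν) hf (Real.sqrt δ)
    have h2 := h (Real.sqrt δ) (Real.sqrt_pos.mpr hδ)
      ((Real.sqrt_lt' hε₀).mpr (hδlt.trans_le (min_le_left _ _)))
    rw [hs] at h1 h2
    rw [ENNReal.ofReal_coe_nnreal] at h1
    refine h1.trans ?_
    gcongr
    refine h2.trans ?_
    gcongr
    exact lintegral_exp_mul_le hp hp0 hpB hδB
  -- One admissible `δ` already shows the double integral to be finite, which allows passing to real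
  -- arithmetic.
  have hV : ∫⁻ z, ENNReal.ofReal ((f z.1 - f z.2) ^ 2) ∂(ν.prod ν) ≠ ⊤ := by
    intro hV
    obtain ⟨δ, hδ, hlt⟩ : ∃ δ : NNReal, 0 < δ ∧ (δ : ℝ) < δ₀ :=
      ⟨(δ₀ / 2).toNNReal, by simpa using hδ₀pos, by
        rw [Real.coe_toNNReal _ (by positivity)]; exact half_lt_self hδ₀pos⟩
    have := key δ hδ hlt
    rw [hV, ENNReal.mul_top (ENNReal.coe_ne_zero.mpr hδ.ne'), add_top, top_le_iff] at this
    refine ENNReal.mul_ne_top (by norm_num) (ENNReal.pow_ne_top ?_) this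
    refine ENNReal.add_ne_top.mpr ⟨ENNReal.add_ne_top.mpr ⟨hZ, ENNReal.mul_ne_top ?_ hP⟩,
      ENNReal.mul_ne_top (ENNReal.pow_ne_top ENNReal.coe_ne_top) hD⟩
    exact ENNReal.div_ne_top ENNReal.coe_ne_top (by norm_num)
  generalize ∫⁻ z, ENNReal.ofReal ((f z.1 - f z.2) ^ 2) ∂(ν.prod ν) = V at *
  generalize ENNReal.ofReal (B ^ 2) * ν Set.univ = D at *
  generalize ν Set.univ = Z at *
  generalize ∫⁻ x, ENNReal.ofReal (p x) ∂ν = P at *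
  lift V to NNReal using hV
  lift D to NNReal using hD
  lift Z to NNReal using hZ
  lift P to NNReal using hP
  have := le_two_mul_mul_of_forall_small (Z := Z) (V := V) (P := P) (D := D) hδ₀pos fun δ hδ hlt => by
    have := key δ hδ hlt
    rw [show (2 : ℝ≥0∞) = ((2 : NNReal) : ℝ≥0∞) from rfl, ← ENNReal.coe_div (by norm_num)] at this
    exact_mod_cast this
  exact_mod_cast this

end FiniteMeasure

/-! ### Continuously differentiable functions on compact convex sets -/

section Smooth

variable {n : ℕ} {Φ : EuclideanSpace ℝ (Fin n) → ℝ}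

theorem isLocallyFiniteMeasure_potentialMeasure (hΦ : Continuous Φ) :
    IsLocallyFiniteMeasure (potentialMeasure Φ) :=
  IsLocallyFiniteMeasure.withDensity_ofReal (by fun_prop)

theorem setLIntegral_potentialMeasure (hΦ : Continuous Φ) {K : Set (EuclideanSpace ℝ (Fin n))}
    (hK : MeasurableSet K) (F : EuclideanSpace ℝ (Fin n) → ℝ≥0∞) :
    ∫⁻ x in K, F x ∂(potentialMeasure Φ) =
      ∫⁻ x in K, ENNReal.ofReal (Real.exp (-Φ x)) * F x := by
  rw [potentialMeasure, restrict_withDensity hK,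
    lintegral_withDensity_eq_lintegral_mul_non_measurable _ (by fun_prop) (by simp)]
  rfl

theorem setLIntegral_exp_potentialMeasure (hΦ : Continuous Φ)
    {K : Set (EuclideanSpace ℝ (Fin n))} (hK : MeasurableSet K)
    (s : EuclideanSpace ℝ (Fin n) → ℝ) :
    ∫⁻ x in K, ENNReal.ofReal (Real.exp (s x)) ∂(potentialMeasure Φ) =
      ∫⁻ x, K.indicator (fun x => ENNReal.ofReal (Real.exp (-Φ x + s x))) x := by
  rw [setLIntegral_potentialMeasure hΦ hK, lintegral_indicator hK]
  simp only [← ENNReal.ofReal_mul (Real.exp_nonneg _), ← Real.exp_add]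

/-- The Brascamp–Lieb inequality on a compact convex set, for a continuously differentiable
function. -/
theorem lintegral_sq_sub_le_of_contDiff (hΦ : ContDiff ℝ 2 Φ) (hpos : ∀ x, (hessian Φ x).PosDef)
    {K : Set (EuclideanSpace ℝ (Fin n))} (hK : IsCompact K) (hKc : Convex ℝ K)
    {f : EuclideanSpace ℝ (Fin n) → ℝ} (hf : ContDiff ℝ 1 f) :
    ∫⁻ z, ENNReal.ofReal ((f z.1 - f z.2) ^ 2)
        ∂(((potentialMeasure Φ).restrict K).prod ((potentialMeasure Φ).restrict K)) ≤
      2 * potentialMeasure Φ K * ∫⁻ x in K,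
        ENNReal.ofReal (realInvForm (hessian Φ x) fun j => partialDeriv j f x)
          ∂(potentialMeasure Φ) := by
  have hΦc : Continuous Φ := hΦ.continuous
  have hfc : Continuous f := hf.continuous
  have := isLocallyFiniteMeasure_potentialMeasure hΦc
  have hfin : potentialMeasure Φ K ≠ ⊤ := hK.measure_lt_top.ne
  have : IsFiniteMeasure ((potentialMeasure Φ).restrict K) := ⟨by simpa using hfin.lt_top⟩
  have hf' : Continuous (fderiv ℝ f) := hf.continuous_fderiv (by norm_num)
  set q : EuclideanSpace ℝ (Fin n) → ℝ :=
    fun x => realInvForm (hessian Φ x) fun j => partialDeriv j f x with hq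
  have hqc : Continuous q := continuous_realInvForm hΦ hpos continuous_id
    (continuous_pi fun j => by unfold partialDeriv; fun_prop)
  obtain ⟨B, hB⟩ := hK.exists_bound_of_continuousOn hqc.continuousOn
  have key : ∀ η : ℝ, 0 < η → ∫⁻ z, ENNReal.ofReal ((f z.1 - f z.2) ^ 2)
        ∂(((potentialMeasure Φ).restrict K).prod ((potentialMeasure Φ).restrict K)) ≤
      2 * potentialMeasure Φ K * ∫⁻ x in K, ENNReal.ofReal (q x + η) ∂(potentialMeasure Φ) := by
    intro η hη
    obtain ⟨ε₀, hε₀, hmid⟩ := midpoint_le hΦ hpos hK hKc hf hη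
    have hmain := lintegral_sq_sub_le_of_forall_exp (ν := (potentialMeasure Φ).restrict K)
      hfc.measurable (p := fun x => q x + η) (by fun_prop) (B := B + η)
      (.of_forall fun x => add_nonneg (realInvForm_nonneg (hpos x) _) hη.le)
      (by filter_upwards [ae_restrict_mem hK.measurableSet] with x hx
          have := (le_abs_self _).trans (hB x hx)
          linarith) hε₀ (fun ε h0 h1 => by
        simp only [setLIntegral_exp_potentialMeasure hΦc hK.measurableSet]
        refine midpointPrekopaLeindler_euclideanSpace n _ _ _
          (Measurable.indicator (by fun_prop) hK.measurableSet)
          (Measurable.indicator (by fun_prop) hK.measurableSet)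
          (Measurable.indicator (by fun_prop) hK.measurableSet) fun x y => ?_
        by_cases hx : x ∈ K
        · by_cases hy : y ∈ K
          -- Convexity of `K` makes the indicators compatible with midpoints.
          · have hz : (1 / 2 : ℝ) • (x + y) ∈ K := by
              rw [smul_add]
              exact hKc hx hy (by norm_num) (by norm_num) (by norm_num)
            rw [Set.indicator_of_mem hx, Set.indicator_of_mem hy, Set.indicator_of_mem hz,
              ← ENNReal.ofReal_mul (Real.exp_nonneg _), ← ENNReal.ofReal_pow (Real.exp_nonneg _),
              ← Real.exp_add, ← Real.exp_nat_mul]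
            refine ENNReal.ofReal_le_ofReal (Real.exp_le_exp.mpr ?_)
            exact_mod_cast hmid ε h0 h1 x hx y hy
          · simp [hy]
        · simp [hx])
    simpa using hmain
  have hlim : Tendsto (fun η : ℝ => 2 * potentialMeasure Φ K *
      ((∫⁻ x in K, ENNReal.ofReal (q x) ∂(potentialMeasure Φ)) +
        ENNReal.ofReal η * potentialMeasure Φ K)) (𝓝[>] 0)
      (𝓝 (2 * potentialMeasure Φ K *
      ((∫⁻ x in K, ENNReal.ofReal (q x) ∂(potentialMeasure Φ)) +
        ENNReal.ofReal 0 * potentialMeasure Φ K))) := by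
    refine ENNReal.Tendsto.const_mul (tendsto_const_nhds.add (ENNReal.Tendsto.mul_const
      ((ENNReal.continuous_ofReal.tendsto 0).mono_left nhdsWithin_le_nhds) (Or.inr hfin))) ?_
    exact Or.inr (ENNReal.mul_ne_top (by norm_num) hfin)
  simp only [ENNReal.ofReal_zero, zero_mul, add_zero] at hlim
  refine ge_of_tendsto hlim ?_
  filter_upwards [self_mem_nhdsWithin] with η hη
  refine (key η hη).trans_eq ?_
  congr 1
  have hη : (0 : ℝ) < η := hη
  simp only [ENNReal.ofReal_add (realInvForm_nonneg (hpos _) _) hη.le, hq]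
  rw [lintegral_add_right _ (by fun_prop), lintegral_const, Measure.restrict_apply_univ]

end Smooth

/-! ### Weak gradients and mollification -/

section Mollify

variable {n : ℕ} {Φ : EuclideanSpace ℝ (Fin n) → ℝ}

/-- `g` is the weak gradient of the real-valued function `f`. -/
structure IsRealWeakGradient (f : EuclideanSpace ℝ (Fin n) → ℝ)
    (g : EuclideanSpace ℝ (Fin n) → Fin n → ℝ) : Prop where
  locallyIntegrable : LocallyIntegrable f volume
  locallyIntegrable_grad : ∀ j, LocallyIntegrable (fun x => g x j) volume
  integral_eq : ∀ (j : Fin n) (φ : EuclideanSpace ℝ (Fin n) → ℝ),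
    ContDiff ℝ ∞ φ → HasCompactSupport φ →
      ∫ x, f x * partialDeriv j φ x = -∫ x, g x j * φ x

theorem LocallyIntegrable.clm_comp {X E F : Type*} [TopologicalSpace X] [MeasurableSpace X]
    [NormedAddCommGroup E] [NormedSpace ℝ E] [NormedAddCommGroup F] [NormedSpace ℝ F]
    {μ : Measure X} {f : X → E} (hf : LocallyIntegrable f μ) (L : E →L[ℝ] F) :
    LocallyIntegrable (fun x => L (f x)) μ := fun x => by
  obtain ⟨s, hs, h⟩ := hf x
  exact ⟨s, hs, L.integrable_comp h⟩

theorem partialDeriv_clm_comp {F G : Type*} [NormedAddCommGroup F] [NormedSpace ℝ F]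
    [NormedAddCommGroup G] [NormedSpace ℝ G] (L : F →L[ℝ] G) (j : Fin n)
    {u : EuclideanSpace ℝ (Fin n) → F} (hu : Differentiable ℝ u) (x : EuclideanSpace ℝ (Fin n)) :
    partialDeriv j (fun y => L (u y)) x = L (partialDeriv j u x) := by
  unfold partialDeriv
  have h : HasFDerivAt (fun y => L (u y)) (L.comp (fderiv ℝ u x)) x :=
    L.hasFDerivAt.comp x (hu x).hasFDerivAt
  rw [h.fderiv]
  rfl

theorem continuous_partialDeriv {F : Type*} [NormedAddCommGroup F] [NormedSpace ℝ F] (j : Fin n)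
    {u : EuclideanSpace ℝ (Fin n) → F} (hu : ContDiff ℝ 1 u) : Continuous (partialDeriv j u) := by
  have := hu.continuous_fderiv (by norm_num)
  unfold partialDeriv
  fun_prop

theorem hasCompactSupport_partialDeriv {F : Type*} [NormedAddCommGroup F] [NormedSpace ℝ F]
    (j : Fin n) {u : EuclideanSpace ℝ (Fin n) → F} (hu : HasCompactSupport u) :
    HasCompactSupport (partialDeriv j u) :=
  (hu.fderiv (𝕜 := ℝ)).comp_left 
    (g := fun L : EuclideanSpace ℝ (Fin n) →L[ℝ] F => L (EuclideanSpace.single j 1)) rfl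

/-- A real-linear image (such as the real or the imaginary part) of a complex function with a weak
gradient has the image of the gradient as its weak gradient. -/
theorem IsWeakGradient.clm_comp {f : EuclideanSpace ℝ (Fin n) → ℂ}
    {g : EuclideanSpace ℝ (Fin n) → Fin n → ℂ} (h : IsWeakGradient f g) (L : ℂ →L[ℝ] ℝ) :
    IsRealWeakGradient (fun x => L (f x)) fun x j => L (g x j) where
  locallyIntegrable := LocallyIntegrable.clm_comp h.locallyIntegrable L
  locallyIntegrable_grad j := LocallyIntegrable.clm_comp (h.locallyIntegrable_grad j) L
  integral_eq j φ hφ hφs := by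
    have hmul : ∀ (z : ℂ) (r : ℝ), L z * r = L (r • z) := fun z r => by
      rw [map_smul, smul_eq_mul, mul_comm]
    have hφ1 : ContDiff ℝ 1 φ := hφ.of_le (by exact_mod_cast le_top)
    have h1 := h.integral_eq j (fun x => Complex.ofRealCLM (φ x))
      (Complex.ofRealCLM.contDiff.comp hφ) (hφs.comp_left (g := Complex.ofRealCLM) (by simp))
    have h2 : ∀ x, partialDeriv j (fun x => (φ x : ℂ)) x = (partialDeriv j φ x : ℝ) :=
      partialDeriv_clm_comp Complex.ofRealCLM j (hφ1.differentiable (by norm_num))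
    simp only [Complex.ofRealCLM_apply, h2] at h1
    have hcomm : ∀ (z : ℂ) (r : ℝ), z * (r : ℂ) = r • z := fun z r => by
      rw [Complex.real_smul, mul_comm]
    simp only [hcomm] at h1
    simp only [hmul]
    rw [L.integral_comp_comm, L.integral_comp_comm, h1, map_neg]
    · exact (h.locallyIntegrable_grad j).integrable_smul_left_of_hasCompactSupport
        hφ.continuous hφs
    · exact h.locallyIntegrable.integrable_smul_left_of_hasCompactSupport
        (continuous_partialDeriv j hφ1) (hasCompactSupport_partialDeriv j hφs)

theorem contDiff_convolution_of_locallyIntegrable {ρ f : EuclideanSpace ℝ (Fin n) → ℝ}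
    (hρ : ContDiff ℝ ∞ ρ) (hρs : HasCompactSupport ρ) (hf : LocallyIntegrable f volume) :
    ContDiff ℝ 1 (ρ ⋆[ContinuousLinearMap.lsmul ℝ ℝ, volume] f) :=
  hρs.contDiff_convolution_left (n := 1) _ (hρ.of_le (by exact_mod_cast le_top)) hf

/-- The derivative falls on the kernel, and `t ↦ ρ (x - t)` is a test function; the sign from
reflection cancels the one from integration by parts. -/
theorem IsRealWeakGradient.partialDeriv_convolution {f : EuclideanSpace ℝ (Fin n) → ℝ}
    {g : EuclideanSpace ℝ (Fin n) → Fin n → ℝ} (h : IsRealWeakGradient f g)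
    {ρ : EuclideanSpace ℝ (Fin n) → ℝ} (hρ : ContDiff ℝ ∞ ρ) (hρs : HasCompactSupport ρ)
    (j : Fin n) (x : EuclideanSpace ℝ (Fin n)) :
    partialDeriv j (ρ ⋆[ContinuousLinearMap.lsmul ℝ ℝ, volume] f) x = ∫ t, ρ (x - t) * g t j := by
  have hρ1 : ContDiff ℝ 1 ρ := hρ.of_le (by exact_mod_cast le_top)
  have hd := hρs.hasFDerivAt_convolution_right (ContinuousLinearMap.lsmul ℝ ℝ).flip
    h.locallyIntegrable hρ1 x
  rw [convolution_flip] at hd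
  rw [partialDeriv, hd.fderiv, convolution_precompR_apply _ h.locallyIntegrable
    (hρs.fderiv (𝕜 := ℝ)) (hρ1.continuous_fderiv (by norm_num)), convolution_def]
  have hsub : ∀ t, HasFDerivAt (fun t => x - t) (-ContinuousLinearMap.id ℝ _) t := fun t =>
    (hasFDerivAt_id t).const_sub x
  have h1 := h.integral_eq j (fun t => ρ (x - t)) (hρ.comp (contDiff_const.sub contDiff_id))
    (hρs.comp_homeomorph (Homeomorph.subLeft x))
  have h2 : ∀ t, partialDeriv j (fun t => ρ (x - t)) t =
      -fderiv ℝ ρ (x - t) (EuclideanSpace.single j 1) := fun t => by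
    have hc := ((hρ1.differentiable (by norm_num)) (x - t)).hasFDerivAt.comp t (hsub t)
    have : HasFDerivAt (fun t => ρ (x - t)) _ t := hc
    rw [partialDeriv, this.fderiv]
    simp
  simp only [h2, mul_neg, integral_neg, neg_inj] at h1
  simp only [ContinuousLinearMap.flip_apply, ContinuousLinearMap.lsmul_apply, smul_eq_mul,
    mul_comm _ (f _), mul_comm _ (g _ _)]
  exact h1

/-- Uniform continuity near `K` suffices: a Hessian error of at most `(θ - 1) m ‖w‖²` is absorbed by
the lower bound `m` at `x`. -/
theorem exists_forall_near_exp_le_and_hessian_le (hΦ : ContDiff ℝ 2 Φ)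
    (hpos : ∀ x, (hessian Φ x).PosDef) {K : Set (EuclideanSpace ℝ (Fin n))} (hK : IsCompact K)
    {θ : ℝ} (hθ : 1 < θ) :
    ∃ δ > 0, ∀ x ∈ K, ∀ t, ‖x - t‖ < δ → Real.exp (-Φ x) ≤ θ * Real.exp (-Φ t) ∧
      ∀ w : EuclideanSpace ℝ (Fin n),
        fderiv ℝ (fderiv ℝ Φ) t w w ≤ θ * fderiv ℝ (fderiv ℝ Φ) x w w := by
  obtain ⟨m, hm, hmK⟩ := exists_pos_mul_sq_le_fderiv_fderiv hΦ hpos hK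
  obtain ⟨δ₁, hδ₁, h₁⟩ := hK.exists_norm_sub_lt_of_continuous hΦ.continuous (Real.log_pos hθ)
  obtain ⟨δ₂, hδ₂, h₂⟩ := hK.exists_norm_sub_lt_of_continuous
    (F := fderiv ℝ (fderiv ℝ Φ)) (continuous_fderiv_fderiv hΦ)
    (ρ := (θ - 1) * m) (mul_pos (by linarith) hm)
  refine ⟨min δ₁ δ₂, lt_min hδ₁ hδ₂, fun x hx t hxt => ⟨?_, fun w => ?_⟩⟩
  · have := (neg_le_abs _).trans (h₁ x hx t (hxt.trans_le (min_le_left _ _))).le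
    rw [← Real.exp_log (by linarith : 0 < θ), ← Real.exp_add]
    exact Real.exp_le_exp.mpr (by linarith)
  · have hd := (h₂ x hx t (hxt.trans_le (min_le_right _ _))).le
    have hle := (neg_le_abs _).trans (ContinuousLinearMap.le_opNorm₂ (fderiv ℝ (fderiv ℝ Φ) x -
        fderiv ℝ (fderiv ℝ Φ) t) w w)
    simp only [sub_apply] at hle
    have h3 : ‖fderiv ℝ (fderiv ℝ Φ) x - fderiv ℝ (fderiv ℝ Φ) t‖ * ‖w‖ * ‖w‖ ≤
        ((θ - 1) * m) * ‖w‖ * ‖w‖ := by gcongr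
    nlinarith [hmK x hx w]

theorem ofReal_integral_le_lintegral_ofReal {α : Type*} [MeasurableSpace α] {μ : Measure α}
    {f : α → ℝ} (hf : Integrable f μ) :
    ENNReal.ofReal (∫ x, f x ∂μ) ≤ ∫⁻ x, ENNReal.ofReal (f x) ∂μ := by
  rw [integral_eq_lintegral_pos_part_sub_lintegral_neg_part hf]
  exact (ENNReal.ofReal_le_ofReal (sub_le_self _ ENNReal.toReal_nonneg)).trans
    ENNReal.ofReal_toReal_le

/-- Jensen's inequality for the inverse Hessian form, with comparison of nearby Hessians. -/
theorem ofReal_realInvForm_integral_le (hΦ : ContDiff ℝ 2 Φ) (hpos : ∀ x, (hessian Φ x).PosDef)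
    {θ : ℝ} (hθ : 0 < θ) {k : EuclideanSpace ℝ (Fin n) → ℝ} (hk0 : ∀ t, 0 ≤ k t)
    (hki : Integrable k) (hk1 : ∫ t, k t = 1) {x : EuclideanSpace ℝ (Fin n)}
    (hx : ∀ t, k t ≠ 0 → ∀ w : EuclideanSpace ℝ (Fin n),
      fderiv ℝ (fderiv ℝ Φ) t w w ≤ θ * fderiv ℝ (fderiv ℝ Φ) x w w)
    {g : EuclideanSpace ℝ (Fin n) → Fin n → ℝ} (hg : ∀ j, Integrable fun t => k t * g t j) :
    ENNReal.ofReal (realInvForm (hessian Φ x) fun j => ∫ t, k t * g t j) ≤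
      ∫⁻ t, ENNReal.ofReal (k t) * ENNReal.ofReal (θ * realInvForm (hessian Φ t) (g t)) := by
  set v : Fin n → ℝ := fun j => ∫ t, k t * g t j with hv
  -- Fixing the maximiser `w` for the averaged vector makes the dual expression affine in `g t`, so
  -- it can be averaged and then bounded pointwise by duality at `t`.
  set w : Fin n → ℝ := (hessian Φ x)⁻¹ *ᵥ v with hw
  set a := w ⬝ᵥ (hessian Φ x *ᵥ w) with ha
  have hi1 : Integrable fun t => 2 * ∑ j, k t * g t j * w j :=
    (integrable_finsetSum _ fun j _ => (hg j).mul_const _).const_mul 2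
  have hi2 : Integrable fun t => k t * a := hki.mul_const a
  have e : realInvForm (hessian Φ x) v = ∫ t, (2 * ∑ j, k t * g t j * w j - k t * a) := by
    rw [integral_sub hi1 hi2, integral_const_mul, integral_mul_const, hk1, one_mul,
      integral_finsetSum _ fun j _ => (hg j).mul_const _]
    simp only [integral_mul_const]
    exact (two_mul_dotProduct_sub_eq (hpos x) v).symm
  rw [e]
  refine (ofReal_integral_le_lintegral_ofReal (hi1.sub hi2)).trans (lintegral_mono fun t => ?_)
  simp only [Pi.sub_apply]
  rw [← ENNReal.ofReal_mul (hk0 t)]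
  refine ENNReal.ofReal_le_ofReal ?_
  have e2 : 2 * ∑ j, k t * g t j * w j - k t * a = k t * (2 * (g t ⬝ᵥ w) - a) := by
    simp only [dotProduct, mul_assoc, ← Finset.mul_sum]
    ring
  rw [e2]
  rcases eq_or_ne (k t) 0 with h0 | h0
  · simp [h0]
  refine mul_le_mul_of_nonneg_left ?_ (hk0 t)
  have h1 := hx t h0 (WithLp.toLp 2 w)
  rw [fderiv_fderiv_apply_eq hΦ, fderiv_fderiv_apply_eq hΦ] at h1
  have h2 := two_mul_dotProduct_sub_le (hpos t) (inv_pos.mpr hθ) (g t) w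
  rw [div_inv_eq_mul, mul_comm _ θ] at h2
  have h3 : θ⁻¹ * (w ⬝ᵥ (hessian Φ t *ᵥ w)) ≤ a := by
    rw [inv_mul_le_iff₀ hθ]; exact h1
  linarith

theorem aemeasurable_realInvForm (hΦ : ContDiff ℝ 2 Φ) (hpos : ∀ x, (hessian Φ x).PosDef)
    {g : EuclideanSpace ℝ (Fin n) → Fin n → ℝ} {μ : Measure (EuclideanSpace ℝ (Fin n))}
    (hg : ∀ j, AEMeasurable (fun x => g x j) μ) :
    AEMeasurable (fun x => realInvForm (hessian Φ x) (g x)) μ := by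
  have h : Continuous fun p : EuclideanSpace ℝ (Fin n) × (Fin n → ℝ) =>
      realInvForm (hessian Φ p.1) p.2 :=
    continuous_realInvForm hΦ hpos continuous_fst continuous_snd
  exact h.measurable.comp_aemeasurable (aemeasurable_id.prodMk (aemeasurable_pi_lambda _ hg))

theorem lintegral_potentialMeasure (hΦ : Continuous Φ) (F : EuclideanSpace ℝ (Fin n) → ℝ≥0∞) :
    ∫⁻ x, F x ∂(potentialMeasure Φ) = ∫⁻ x, ENNReal.ofReal (Real.exp (-Φ x)) * F x := by
  simpa using setLIntegral_potentialMeasure hΦ MeasurableSet.univ F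

/-- One factor `θ` pays for moving the density from `x` to `t`, the other for moving the Hessian.
Tonelli and the unit mass of the kernel then remove the convolution. -/
theorem setLIntegral_realInvForm_convolution_le (hΦ : ContDiff ℝ 2 Φ)
    (hpos : ∀ x, (hessian Φ x).PosDef) {K : Set (EuclideanSpace ℝ (Fin n))} (hK : IsCompact K)
    {θ : ℝ} (hθ : 1 < θ) {f : EuclideanSpace ℝ (Fin n) → ℝ}
    {g : EuclideanSpace ℝ (Fin n) → Fin n → ℝ} (h : IsRealWeakGradient f g) :
    ∃ δ > 0, ∀ ρ : ContDiffBump (0 : EuclideanSpace ℝ (Fin n)), ρ.rOut < δ →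
      ∫⁻ x in K, ENNReal.ofReal (realInvForm (hessian Φ x) fun j =>
          partialDeriv j (ρ.normed volume ⋆[ContinuousLinearMap.lsmul ℝ ℝ, volume] f) x)
          ∂(potentialMeasure Φ) ≤
        ENNReal.ofReal (θ ^ 2) *
          ∫⁻ x, ENNReal.ofReal (realInvForm (hessian Φ x) (g x)) ∂(potentialMeasure Φ) := by
  obtain ⟨δ, hδ, hnear⟩ := exists_forall_near_exp_le_and_hessian_le hΦ hpos hK hθ
  have hθ0 : 0 < θ := by linarith
  have hΦc := hΦ.continuous
  refine ⟨δ, hδ, fun ρ hρ => ?_⟩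
  have hρc : ContDiff ℝ ∞ (ρ.normed volume) := ρ.contDiff_normed
  have hρs : HasCompactSupport (ρ.normed volume) := ρ.hasCompactSupport_normed
  have hρm : Measurable (ρ.normed volume) := hρc.continuous.measurable
  have hρint : Integrable (ρ.normed volume) volume := ρ.integrable_normed
  have hsupp : ∀ x t, ρ.normed volume (x - t) ≠ 0 → ‖x - t‖ < δ := fun x t hne => by
    have : x - t ∈ Function.support (ρ.normed volume) := hne
    rw [ρ.support_normed_eq, mem_ball_zero_iff] at this
    exact this.trans hρ
  set G : EuclideanSpace ℝ (Fin n) → ℝ≥0∞ := fun t => ENNReal.ofReal (θ ^ 2) *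
    (ENNReal.ofReal (Real.exp (-Φ t)) * ENNReal.ofReal (realInvForm (hessian Φ t) (g t))) with hG
  have hGm : AEMeasurable G := by
    have := aemeasurable_realInvForm hΦ hpos (μ := volume)
      fun j => (h.locallyIntegrable_grad j).aestronglyMeasurable.aemeasurable
    have h2 : Measurable fun t => ENNReal.ofReal (Real.exp (-Φ t)) := by fun_prop
    exact (h2.aemeasurable.mul this.ennreal_ofReal).const_mul _
  have hpt : ∀ x ∈ K, ENNReal.ofReal (Real.exp (-Φ x)) *
      ENNReal.ofReal (realInvForm (hessian Φ x) fun j =>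
          partialDeriv j (ρ.normed volume ⋆[ContinuousLinearMap.lsmul ℝ ℝ, volume] f) x) ≤
      ∫⁻ t, ENNReal.ofReal (ρ.normed volume (x - t)) * G t := by
    intro x hx
    simp only [h.partialDeriv_convolution hρc hρs]
    have hJ := ofReal_realInvForm_integral_le hΦ hpos hθ0
      (k := fun t => ρ.normed volume (x - t)) (fun t => ρ.nonneg_normed _)
      (hρint.comp_sub_left x) (by rw [integral_sub_left_eq_self]; exact ρ.integral_normed) (x := x)
      (fun t ht => (hnear x hx t (hsupp x t ht)).2) (g := g)
      (fun j => (h.locallyIntegrable_grad j).integrable_smul_left_of_hasCompactSupport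
        (hρc.continuous.comp (continuous_const.sub continuous_id))
        (hρs.comp_homeomorph (Homeomorph.subLeft x)))
    refine (mul_le_mul_right hJ _).trans ?_
    rw [← lintegral_const_mul' _ _ ENNReal.ofReal_ne_top]
    refine lintegral_mono fun t => ?_
    simp only
    rcases eq_or_ne (ρ.normed volume (x - t)) 0 with h0 | h0
    · simp [h0]
    have hexp := (hnear x hx t (hsupp x t h0)).1
    rw [mul_left_comm, hG]
    simp only
    refine mul_le_mul_right ?_ _
    rw [ENNReal.ofReal_mul hθ0.le, ← mul_assoc, ← mul_assoc]
    refine mul_le_mul_left ?_ _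
    rw [← ENNReal.ofReal_mul (Real.exp_nonneg _), ← ENNReal.ofReal_mul (by positivity)]
    refine ENNReal.ofReal_le_ofReal ?_
    nlinarith
  calc _ = ∫⁻ x in K, ENNReal.ofReal (Real.exp (-Φ x)) *
        ENNReal.ofReal (realInvForm (hessian Φ x) fun j =>
          partialDeriv j (ρ.normed volume ⋆[ContinuousLinearMap.lsmul ℝ ℝ, volume] f) x) :=
        setLIntegral_potentialMeasure hΦc hK.measurableSet _
    _ ≤ ∫⁻ x in K, ∫⁻ t, ENNReal.ofReal (ρ.normed volume (x - t)) * G t :=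
        setLIntegral_mono' hK.measurableSet hpt
    _ ≤ ∫⁻ x, ∫⁻ t, ENNReal.ofReal (ρ.normed volume (x - t)) * G t :=
        setLIntegral_le_lintegral _ _
    _ = ∫⁻ t, ∫⁻ x, ENNReal.ofReal (ρ.normed volume (x - t)) * G t := by
        refine lintegral_lintegral_swap (AEMeasurable.mul ?_ hGm.comp_snd)
        fun_prop
    _ = ∫⁻ t, G t := by
        refine lintegral_congr fun t => ?_
        rw [lintegral_mul_const _ (by fun_prop),
          lintegral_sub_right_eq_self (fun x => ENNReal.ofReal (ρ.normed volume x)) t,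
          ← ofReal_integral_eq_lintegral_ofReal hρint (.of_forall fun x => ρ.nonneg_normed x),
          ρ.integral_normed, ENNReal.ofReal_one, one_mul]
    _ = _ := by
        rw [lintegral_potentialMeasure hΦc, hG, lintegral_const_mul' _ _ ENNReal.ofReal_ne_top]

end Mollify

/-! ### Removing the mollification and exhausting the space -/

section Limit

variable {n : ℕ} {Φ : EuclideanSpace ℝ (Fin n) → ℝ}

theorem potentialMeasure_absolutelyContinuous :
    potentialMeasure Φ ≪ volume := withDensity_absolutelyContinuous _ _

/-- Fatou's lemma for the double-integral form of the variance. -/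
theorem lintegral_sq_sub_le_of_tendsto_ae {α : Type*} [MeasurableSpace α] {ν : Measure α}
    [SFinite ν] {F : ℕ → α → ℝ} {f : α → ℝ} (hF : ∀ k, Measurable (F k))
    (hlim : ∀ᵐ x ∂ν, Tendsto (fun k => F k x) atTop (𝓝 (f x))) {C : ℝ≥0∞}
    (hC : ∀ᶠ k in atTop, ∫⁻ z, ENNReal.ofReal ((F k z.1 - F k z.2) ^ 2) ∂(ν.prod ν) ≤ C) :
    ∫⁻ z, ENNReal.ofReal ((f z.1 - f z.2) ^ 2) ∂(ν.prod ν) ≤ C := by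
  have h1 : ∀ᵐ z ∂(ν.prod ν), Tendsto (fun k => F k z.1) atTop (𝓝 (f z.1)) :=
    Measure.quasiMeasurePreserving_fst.ae hlim
  have h2 : ∀ᵐ z ∂(ν.prod ν), Tendsto (fun k => F k z.2) atTop (𝓝 (f z.2)) :=
    Measure.quasiMeasurePreserving_snd.ae hlim
  calc _ = ∫⁻ z, liminf (fun k => ENNReal.ofReal ((F k z.1 - F k z.2) ^ 2)) atTop ∂(ν.prod ν) := by
        refine lintegral_congr_ae ?_
        filter_upwards [h1, h2] with z hz1 hz2
        exact (ENNReal.tendsto_ofReal ((hz1.sub hz2).pow 2)).liminf_eq.symm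
    _ ≤ liminf (fun k => ∫⁻ z, ENNReal.ofReal ((F k z.1 - F k z.2) ^ 2) ∂(ν.prod ν)) atTop := by
        refine lintegral_liminf_le fun k => ?_
        have := hF k
        fun_prop
    _ ≤ C := (liminf_le_liminf hC).trans_eq (by simp)

theorem ENNReal.le_of_forall_one_lt_le_sq_mul {a b : ℝ≥0∞}
    (h : ∀ θ : ℝ, 1 < θ → a ≤ ENNReal.ofReal (θ ^ 2) * b) : a ≤ b := by
  rcases eq_or_ne b ⊤ with rfl | hb
  · exact le_top
  have hlim : Tendsto (fun θ : ℝ => ENNReal.ofReal (θ ^ 2) * b) (𝓝[>] 1)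
      (𝓝 (ENNReal.ofReal (1 ^ 2) * b)) :=
    ENNReal.Tendsto.mul_const (((ENNReal.continuous_ofReal.comp (continuous_pow 2)).tendsto
      (1 : ℝ)).mono_left nhdsWithin_le_nhds) (Or.inr hb)
  rw [one_pow, ENNReal.ofReal_one, one_mul] at hlim
  refine ge_of_tendsto hlim ?_
  filter_upwards [self_mem_nhdsWithin] with θ hθ using h θ hθ

/-- The Brascamp–Lieb inequality on a compact convex set, for a function with a weak gradient. -/
theorem IsRealWeakGradient.lintegral_sq_sub_le_of_isCompact (hΦ : ContDiff ℝ 2 Φ)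
    (hpos : ∀ x, (hessian Φ x).PosDef) {K : Set (EuclideanSpace ℝ (Fin n))} (hK : IsCompact K)
    (hKc : Convex ℝ K) {f : EuclideanSpace ℝ (Fin n) → ℝ}
    {g : EuclideanSpace ℝ (Fin n) → Fin n → ℝ} (h : IsRealWeakGradient f g) :
    ∫⁻ z, ENNReal.ofReal ((f z.1 - f z.2) ^ 2)
        ∂(((potentialMeasure Φ).restrict K).prod ((potentialMeasure Φ).restrict K)) ≤
      2 * potentialMeasure Φ K *
        ∫⁻ x, ENNReal.ofReal (realInvForm (hessian Φ x) (g x)) ∂(potentialMeasure Φ) := by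
  have := isLocallyFiniteMeasure_potentialMeasure hΦ.continuous
  refine ENNReal.le_of_forall_one_lt_le_sq_mul fun θ hθ => ?_
  obtain ⟨δ, hδ, hconv⟩ := setLIntegral_realInvForm_convolution_le hΦ hpos hK hθ h
  -- The bounded ratio of the radii, here 2, is what almost everywhere convergence of the
  -- mollifications requires.
  let ρ : ℕ → ContDiffBump (0 : EuclideanSpace ℝ (Fin n)) := fun k =>
    { rIn := 1 / ((k : ℝ) + 1)
      rOut := 2 * (1 / ((k : ℝ) + 1))
      rIn_pos := by positivity
      rIn_lt_rOut := by
        have : (0 : ℝ) < 1 / ((k : ℝ) + 1) := by positivity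
        linarith }
  have hρ : Tendsto (fun k => (ρ k).rOut) atTop (𝓝 0) := by
    simpa only [mul_zero] using (tendsto_one_div_add_atTop_nhds_zero_nat (𝕜 := ℝ)).const_mul 2
  have hae := ContDiffBump.ae_convolution_tendsto_right_of_locallyIntegrable (K := 2) hρ
    (.of_forall fun k => le_rfl) h.locallyIntegrable
  have hsm : ∀ k, ContDiff ℝ 1
      ((ρ k).normed volume ⋆[ContinuousLinearMap.lsmul ℝ ℝ, volume] f) := fun k =>
    contDiff_convolution_of_locallyIntegrable (ρ k).contDiff_normed (ρ k).hasCompactSupport_normed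
      h.locallyIntegrable
  refine lintegral_sq_sub_le_of_tendsto_ae (fun k => (hsm k).continuous.measurable)
    (ae_restrict_of_ae (potentialMeasure_absolutelyContinuous.ae_le hae)) ?_
  filter_upwards [hρ.eventually_lt_const hδ] with k hk
  refine (lintegral_sq_sub_le_of_contDiff hΦ hpos hK hKc (hsm k)).trans ?_
  rw [mul_left_comm]
  gcongr
  exact hconv (ρ k) hk

/-- The double-integral form of the Brascamp–Lieb inequality on the whole space. -/
theorem IsRealWeakGradient.lintegral_sq_sub_le (hΦ : ContDiff ℝ 2 Φ)
    (hpos : ∀ x, (hessian Φ x).PosDef) [IsProbabilityMeasure (potentialMeasure Φ)]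
    {f : EuclideanSpace ℝ (Fin n) → ℝ}
    {g : EuclideanSpace ℝ (Fin n) → Fin n → ℝ} (h : IsRealWeakGradient f g) :
    ∫⁻ z, ENNReal.ofReal ((f z.1 - f z.2) ^ 2)
        ∂((potentialMeasure Φ).prod (potentialMeasure Φ)) ≤
      2 * ∫⁻ x, ENNReal.ofReal (realInvForm (hessian Φ x) (g x)) ∂(potentialMeasure Φ) := by
  let S : ℕ → Set (EuclideanSpace ℝ (Fin n)) := fun N => Metric.closedBall 0 N
  have hmono : Monotone fun N => S N ×ˢ S N := fun M N hMN =>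
    Set.prod_mono (Metric.closedBall_subset_closedBall (by exact_mod_cast hMN))
      (Metric.closedBall_subset_closedBall (by exact_mod_cast hMN))
  have hU : ⋃ N, S N ×ˢ S N = Set.univ := by
    refine Set.eq_univ_of_forall fun z => Set.mem_iUnion.mpr ?_
    obtain ⟨N, hN⟩ := exists_nat_ge (max ‖z.1‖ ‖z.2‖)
    refine ⟨N, ?_, ?_⟩
    · simpa [S] using (le_max_left _ _).trans hN
    · simpa [S] using (le_max_right _ _).trans hN
  rw [← setLIntegral_univ, ← hU, setLIntegral_iUnion_of_directed _ hmono.directed_le]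
  refine iSup_le fun N => ?_
  rw [← Measure.prod_restrict]
  refine (h.lintegral_sq_sub_le_of_isCompact hΦ hpos (isCompact_closedBall _ _)
    (convex_closedBall _ _)).trans ?_
  gcongr
  exact (mul_le_mul_right prob_le_one 2).trans_eq (mul_one 2)

end Limit

/-! ### Variance as a double integral -/

section Variance

variable {α : Type*} [MeasurableSpace α] {μ : Measure α} [IsProbabilityMeasure μ]

theorem lintegral_enorm_add_sq_of_integral_eq_zero {h : α → ℂ} (hh : MemLp h 2 μ)
    (h0 : ∫ x, h x ∂μ = 0) (a : ℂ) :
    ∫⁻ x, ‖a + h x‖ₑ ^ 2 ∂μ = ‖a‖ₑ ^ 2 + ∫⁻ x, ‖h x‖ₑ ^ 2 ∂μ := by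
  have hi : Integrable h μ := hh.integrable (by norm_num)
  have hsq : Integrable (fun x => ‖h x‖ ^ 2) μ := hh.integrable_norm_pow (by norm_num)
  have hin : Integrable (fun x => inner ℝ a (h x)) μ := hi.const_inner a
  have e1 : ∀ z : ℂ, ‖z‖ₑ ^ 2 = ENNReal.ofReal (‖z‖ ^ 2) := fun z => by
    rw [ENNReal.ofReal_pow (norm_nonneg _), ofReal_norm]
  simp only [e1]
  have hint : Integrable (fun x => ‖a‖ ^ 2 + 2 * inner ℝ a (h x) + ‖h x‖ ^ 2) μ :=
    ((integrable_const _).add (hin.const_mul 2)).add hsq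
  simp only [norm_add_sq_real]
  rw [← ofReal_integral_eq_lintegral_ofReal hint (.of_forall fun x => by
      simp only [← norm_add_sq_real]; positivity),
    ← ofReal_integral_eq_lintegral_ofReal hsq (.of_forall fun x => by positivity),
    ← ENNReal.ofReal_add (by positivity) (integral_nonneg fun x => by positivity)]
  congr 1
  have hi1 : Integrable (fun x => ‖a‖ ^ 2 + 2 * inner ℝ a (h x)) μ :=
    (integrable_const _).add (hin.const_mul 2)
  rw [integral_add hi1 hsq, integral_add (integrable_const _) (hin.const_mul 2),
    integral_const_mul, integral_inner hi, h0]
  simp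

/-- Split `f x - f y` at the mean. For fixed `x` the part depending on `y` has integral zero, so the
cross term vanishes. -/
theorem two_mul_lintegral_enorm_sub_integral_sq {f : α → ℂ} (hf : MemLp f 2 μ) :
    2 * ∫⁻ x, ‖f x - ∫ y, f y ∂μ‖ₑ ^ 2 ∂μ = ∫⁻ z, ‖f z.1 - f z.2‖ₑ ^ 2 ∂(μ.prod μ) := by
  set c := ∫ y, f y ∂μ with hc
  have hh : MemLp (fun x => c - f x) 2 μ := (memLp_const c).sub hf
  have h0 : ∫ x, (c - f x) ∂μ = 0 := by
    rw [integral_sub (integrable_const _) (hf.integrable (by norm_num)), ← hc]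
    simp
  have hm : AEMeasurable f μ := hf.aestronglyMeasurable.aemeasurable
  have hm2 : AEMeasurable (fun z : α × α => ‖f z.1 - f z.2‖ₑ ^ 2) (μ.prod μ) :=
    ((hm.comp_fst.sub hm.comp_snd).enorm).pow_const 2
  rw [lintegral_prod _ hm2]
  have e : ∀ x y, f x - f y = (f x - c) + (c - f y) := fun x y => by ring
  simp only [e, lintegral_enorm_add_sq_of_integral_eq_zero hh h0]
  rw [lintegral_add_right' _ aemeasurable_const, lintegral_const, measure_univ, mul_one, two_mul]
  simp only [enorm_sub_rev c]

end Variance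

/-! ### Normalisation and the complex-valued inequality -/

theorem isProbabilityMeasure_potentialMeasure {n : ℕ} {Φ : EuclideanSpace ℝ (Fin n) → ℝ}
    (hnorm : ∫ x, Real.exp (-Φ x) = 1) : IsProbabilityMeasure (potentialMeasure Φ) := by
  have hi : Integrable fun x => Real.exp (-Φ x) := by
    -- The integral of a non-integrable function is 0 by convention, so the value 1 forces
    -- integrability.
    by_contra hi
    rw [integral_undef hi] at hnorm
    exact zero_ne_one hnorm
  constructor
  rw [potentialMeasure, withDensity_apply _ MeasurableSet.univ, Measure.restrict_univ,
    ← ofReal_integral_eq_lintegral_ofReal hi (.of_forall fun x => Real.exp_nonneg _), hnorm,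
    ENNReal.ofReal_one]

/-- Brascamp–Lieb inequality for strictly convex potentials and `f ∈ L²(μ) ∩ H¹_loc`. Both sides
are `[0,∞]`-valued, so that the right-hand side may be infinite; `g` is the (almost everywhere
unique) weak gradient of `f`. -/
theorem corollary1p3 (n : ℕ) (Φ : EuclideanSpace ℝ (Fin n) → ℝ)
    (hΦ : ContDiff ℝ 2 Φ)
    (hnorm : ∫ x, Real.exp (-Φ x) = 1)
    (hconv : ∀ (x : EuclideanSpace ℝ (Fin n)) (z : Fin n → ℂ), z ≠ 0 →
      0 < ∑ j, ∑ k, (hessian Φ x j k : ℂ) * z j * conj (z k))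
    (f : EuclideanSpace ℝ (Fin n) → ℂ)
    (hf : MemLp f 2 (potentialMeasure Φ)) (hf_loc : MemH1loc f)
    (g : EuclideanSpace ℝ (Fin n) → Fin n → ℂ) (hg : IsWeakGradient f g) :
    ∫⁻ x, ‖f x - ∫ y, f y ∂(potentialMeasure Φ)‖ₑ ^ 2 ∂(potentialMeasure Φ) ≤
      ∫⁻ x, ENNReal.ofReal (invForm (hessian Φ x) (g x)).re ∂(potentialMeasure Φ) := by
  have hpos := hessian_posDef hΦ hconv
  have := isProbabilityMeasure_potentialMeasure hnorm
  have hre := (hg.clm_comp Complex.reCLM).lintegral_sq_sub_le hΦ hpos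
  have him := (hg.clm_comp Complex.imCLM).lintegral_sq_sub_le hΦ hpos
  simp only [Complex.reCLM_apply, Complex.imCLM_apply] at hre him
  have hfm : AEMeasurable f (potentialMeasure Φ) := hf.aestronglyMeasurable.aemeasurable
  have hgm : ∀ j, AEMeasurable (fun x => g x j) (potentialMeasure Φ) := fun j =>
    (hg.locallyIntegrable_grad j).aestronglyMeasurable.aemeasurable.mono_ac
      potentialMeasure_absolutelyContinuous
  have hleft : ∫⁻ z, ‖f z.1 - f z.2‖ₑ ^ 2 ∂((potentialMeasure Φ).prod (potentialMeasure Φ)) =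
      (∫⁻ z, ENNReal.ofReal (((f z.1).re - (f z.2).re) ^ 2)
        ∂((potentialMeasure Φ).prod (potentialMeasure Φ))) +
      ∫⁻ z, ENNReal.ofReal (((f z.1).im - (f z.2).im) ^ 2)
        ∂((potentialMeasure Φ).prod (potentialMeasure Φ)) := by
    have hm : AEMeasurable (fun z : EuclideanSpace ℝ (Fin n) × EuclideanSpace ℝ (Fin n) =>
        ENNReal.ofReal (((f z.1).re - (f z.2).re) ^ 2))
        ((potentialMeasure Φ).prod (potentialMeasure Φ)) :=
      (((Complex.measurable_re.comp_aemeasurable hfm.comp_fst).sub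
        (Complex.measurable_re.comp_aemeasurable hfm.comp_snd)).pow_const 2).ennreal_ofReal
    rw [← lintegral_add_left' hm]
    refine lintegral_congr fun z => ?_
    rw [← ENNReal.ofReal_add (by positivity) (by positivity), ← ofReal_norm,
      ← ENNReal.ofReal_pow (norm_nonneg _), Complex.sq_norm, Complex.normSq_apply]
    simp only [Complex.sub_re, Complex.sub_im, sq]
  have hright : ∫⁻ x, ENNReal.ofReal (invForm (hessian Φ x) (g x)).re ∂(potentialMeasure Φ) =
      (∫⁻ x, ENNReal.ofReal (realInvForm (hessian Φ x) fun j => (g x j).re)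
        ∂(potentialMeasure Φ)) +
      ∫⁻ x, ENNReal.ofReal (realInvForm (hessian Φ x) fun j => (g x j).im)
        ∂(potentialMeasure Φ) := by
    have hm : AEMeasurable (fun x =>
        ENNReal.ofReal (realInvForm (hessian Φ x) fun j => (g x j).re)) (potentialMeasure Φ) :=
      (aemeasurable_realInvForm hΦ hpos fun j =>
        Complex.measurable_re.comp_aemeasurable (hgm j)).ennreal_ofReal
    rw [← lintegral_add_left' hm]
    refine lintegral_congr fun x => ?_
    rw [invForm_re, ENNReal.ofReal_add (realInvForm_nonneg (hpos x) _)
      (realInvForm_nonneg (hpos x) _)]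
  -- Doubling both sides turns the variance into the double integral, where the real and imaginary
  -- estimates add.
  rw [← ENNReal.mul_le_mul_iff_right two_ne_zero ENNReal.ofNat_ne_top,
    two_mul_lintegral_enorm_sub_integral_sq hf, hleft, hright, mul_add]
  exact add_le_add hre him
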